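/- Call a complex number admissible if it is neither $0$ nor a negative integer. For admissible $c$ let $F(a,b;c;w)$ denote the Gauss hypergeometric function on $\mathbb{C}\setminus[1,\infty)$, i.e. the analytic continuation to this domain of the series $\sum_{k\ge 0}\frac{(a)_k(b)_k}{k!\,(c)_k}w^k$, $|w|<1$. **Theorem.** Let $a,b,c,z$ be complex numbers such that $z\notin(-\infty,0]$ and $a$, $c-a$, $b$, $c-b$ and $c$ are admissible. Then $$\frac{\Gamma(a)\Gamma(c-a)\Gamma(b)\Gamma(c-b)}{\Gamma(c)}\,F(a,b;c;1-z)=\frac{1}{2\pi i}\int_L\Gamma(a+s)\Gamma(b+s)\Gamma(c-a-b-s)\Gamma(-s)\,z^s\,ds,$$ where $z^s=e^{s\log z}$ with the principal branch of the logarithm, and $L$ is any path from $-i\infty$ to $i\infty$ that has the points $-a-n$ and $-b-n$ $(n=0,1,2,\dots)$ on its left and the points $n$ and $c-a-b+n$ $(n=0,1,2,\dots)$ on its right. Here a path from $-i\infty$ to $i\infty$ is a piecewise $C^1$ path $\gamma:\mathbb{R}\to\mathbb{C}$ with bounded real part and $\operatorname{Im}\gamma(t)\to\pm\infty$ as $t\to\pm\infty$;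 a point is on its left (right) if it can be joined in the complement of the path to all $-x$ (respectively $x$) with $x>0$ sufficiently large; and the integral is a convergent improper integral, the limit of $\int_{T_1}^{T_2}$ as $T_1\to-\infty$, $T_2\to\infty$ independently. Such paths $L$ exist, and $L$ can even be chosen without self-intersections. -/

import Mathlib

open Filter Topology MeasureTheory

/-- `ξ` is admissible if it is neither `0` nor a negative integer. -/
def Admissible (ξ : ℂ) : Prop := ∀ n : ℕ, ξ ≠ -(n : ℂ)

/-- `f` is an analytic function on `ℂ ∖ [1, ∞)` that is given on the unit disc by the Gauss series
`∑ (a)_k (b)_k / (k! (c)_k) w ^ k`. (`ℂ ∖ [1, ∞)` is the set of `w` with `1 - w ∉ (-∞, 0]`;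
it is connected, so two such functions agree on it.) -/
def IsGaussContinuation (a b c : ℂ) (f : ℂ → ℂ) : Prop :=
  DifferentiableOn ℂ f {w | 1 - w ∈ Complex.slitPlane} ∧
    ∀ w : ℂ, ‖w‖ < 1 → f w = ordinaryHypergeometric a b c w

/-- The Gauss hypergeometric function `F(a, b; c; ·)` on `ℂ ∖ [1, ∞)`: the analytic continuation
of the Gauss series. -/
noncomputable def gaussF (a b c : ℂ) : ℂ → ℂ := Classical.epsilon (IsGaussContinuation a b c)

/-- A path is piecewise `C¹` if there is a set of break points, finite in every bounded interval,
such that the path is `C¹` on every compact interval with no break point in its interior. -/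
def IsPiecewiseC1 (γ : ℝ → ℂ) : Prop :=
  Continuous γ ∧ ∃ S : Set ℝ, (∀ R : ℝ, (S ∩ Set.Icc (-R) R).Finite) ∧
    ∀ u v : ℝ, u < v → Disjoint (Set.Ioo u v) S → ContDiffOn ℝ 1 γ (Set.Icc u v)

/-- A piecewise `C¹` path from `-i∞` to `i∞` that stays in a vertical strip. -/
structure IsVerticalPath (γ : ℝ → ℂ) : Prop where
  piecewiseC1 : IsPiecewiseC1 γ
  bounded_re : ∃ B : ℝ, ∀ t, |(γ t).re| ≤ B
  tendsto_bot : Tendsto (fun t => (γ t).im) atBot atBot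
  tendsto_top : Tendsto (fun t => (γ t).im) atTop atTop

/-- `p` lies on the left of `γ`: it can be joined, without meeting `γ`, to the points `-x`,
`x` a large positive real. -/
def LiesLeft (γ : ℝ → ℂ) (p : ℂ) : Prop :=
  ∀ᶠ x : ℝ in atTop, JoinedIn (Set.range γ)ᶜ p (-(x : ℂ))

/-- `p` lies on the right of `γ`: it can be joined, without meeting `γ`, to the points `x`,
`x` a large positive real. -/
def LiesRight (γ : ℝ → ℂ) (p : ℂ) : Prop :=
  ∀ᶠ x : ℝ in atTop, JoinedIn (Set.range γ)ᶜ p (x : ℂ)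

/-- The path `γ` from `-i∞` to `i∞` has the poles of `Γ(a+s)Γ(b+s)` on its left and the poles of
`Γ(c-a-b-s)Γ(-s)` on its right. -/
structure IsBarnesContour (a b c : ℂ) (γ : ℝ → ℂ) : Prop where
  vertical : IsVerticalPath γ
  left_a : ∀ n : ℕ, LiesLeft γ (-a - n)
  left_b : ∀ n : ℕ, LiesLeft γ (-b - n)
  right_zero : ∀ n : ℕ, LiesRight γ n
  right_c : ∀ n : ℕ, LiesRight γ (c - a - b + n)

/-- The integral of `f` along `γ : ℝ → ℂ` converges, as an improper integral at both ends,
and has the value `J`. -/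
def HasContourIntegral (γ : ℝ → ℂ) (f : ℂ → ℂ) (J : ℂ) : Prop :=
  (∀ u v : ℝ, IntervalIntegrable (fun t => f (γ t) * deriv γ t) volume u v) ∧
    Tendsto (fun T : ℝ × ℝ => ∫ t in T.1..T.2, f (γ t) * deriv γ t) (atBot ×ˢ atTop) (𝓝 J)

/-!
The integral does not depend on the contour. Within a vertical strip, subtract from the integrand
finitely many compensated principal parts `(s - p)⁻¹ - (s - q)⁻¹`, `(s - p)⁻²`, …, where `q` lies
outside the strip on the same side of the contour as the pole `p`; these integrate to `0` as `p`
and `q` can be joined off the contour, and what remains is holomorphic in the strip, where it has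
a primitive. Decay comes from rotating Euler's integral by `±π/3`: in vertical strips each Gamma
factor is `O(exp (-(π/3) |Im s|))`, and the four together beat `z ^ s = O(exp (π |Im s|))`.

At `z = 1` the integral is given by Barnes' first lemma. When all four parameters have positive
real part, the contour can be taken to be the imaginary axis, and the lemma is Parseval's identity
for the Mellin transform of `(1 + u) ^ (-r)`. Moving the contour by `1` yields contiguity
relations, by which the parameters can be raised until that case applies.

Along a smooth contour one may differentiate in `z` under the integral sign, which raises one
parameter by `1`. So all Taylor coefficients at `z = 1` are instances of Barnes' first lemma, and
they are the coefficients of the Gauss series in `1 - z`. The general case is analytic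
continuation.
-/

section ContourIntegral

namespace HasContourIntegral

variable {γ : ℝ → ℂ} {f g : ℂ → ℂ} {J K : ℂ}

theorem unique (hf : HasContourIntegral γ f J) (hg : HasContourIntegral γ f K) : J = K :=
  tendsto_nhds_unique hf.2 hg.2

theorem congr (hf : HasContourIntegral γ f J) (h : ∀ t, f (γ t) = g (γ t)) :
    HasContourIntegral γ g J := by
  simpa only [HasContourIntegral, h] using hf

theorem add (hf : HasContourIntegral γ f J) (hg : HasContourIntegral γ g K) :
    HasContourIntegral γ (fun s => f s + g s) (J + K) := by
  simp only [HasContourIntegral, add_mul]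
  refine ⟨fun u v => (hf.1 u v).add (hg.1 u v), (hf.2.add hg.2).congr fun T => ?_⟩
  exact (intervalIntegral.integral_add (hf.1 _ _) (hg.1 _ _)).symm

theorem const_mul (c : ℂ) (hf : HasContourIntegral γ f J) :
    HasContourIntegral γ (fun s => c * f s) (c * J) := by
  simp only [HasContourIntegral, mul_assoc]
  refine ⟨fun u v => (hf.1 u v).const_mul c, (hf.2.const_mul c).congr fun T => ?_⟩
  exact (intervalIntegral.integral_const_mul _ _).symm

theorem neg (hf : HasContourIntegral γ f J) : HasContourIntegral γ (fun s => -f s) (-J) := by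
  simpa only [neg_one_mul] using hf.const_mul (-1)

theorem sub (hf : HasContourIntegral γ f J) (hg : HasContourIntegral γ g K) :
    HasContourIntegral γ (fun s => f s - g s) (J - K) := by
  simpa only [sub_eq_add_neg] using hf.add hg.neg

theorem sum {ι : Type*} {f : ι → ℂ → ℂ} {J : ι → ℂ} (u : Finset ι)
    (h : ∀ i ∈ u, HasContourIntegral γ (f i) (J i)) :
    HasContourIntegral γ (fun s => ∑ i ∈ u, f i s) (∑ i ∈ u, J i) := by
  classical
  induction u using Finset.induction_on with
  | empty => simp [HasContourIntegral]
  | insert i u hi ih =>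
    simp only [Finset.sum_insert hi]
    exact (h i (u.mem_insert_self i)).add (ih fun j hj => h j (Finset.mem_insert_of_mem hj))

theorem comp_add_const {c : ℂ} (hf : HasContourIntegral (fun t => γ t + c) f J) :
    HasContourIntegral γ (fun s => f (s + c)) J := by
  simpa only [HasContourIntegral, deriv_add_const] using hf

theorem of_integrable (h : Integrable fun t => f (γ t) * deriv γ t) :
    HasContourIntegral γ f (∫ t, f (γ t) * deriv γ t) :=
  ⟨fun _ _ => h.intervalIntegrable, intervalIntegral_tendsto_integral h tendsto_fst tendsto_snd⟩

end HasContourIntegral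

theorem integrableOn_deriv_Ioo_of_contDiffOn_Icc {γ : ℝ → ℂ} {u v : ℝ} (huv : u < v)
    (h : ContDiffOn ℝ 1 γ (Set.Icc u v)) : IntegrableOn (deriv γ) (Set.Ioo u v) := by
  have hcont := h.continuousOn_derivWithin (uniqueDiffOn_Icc huv) le_rfl
  refine ((hcont.integrableOn_compact isCompact_Icc).mono_set Set.Ioo_subset_Icc_self).congr_fun
    (fun x hx => ?_) measurableSet_Ioo
  exact derivWithin_of_mem_nhds (Icc_mem_nhds hx.1 hx.2)

theorem eventually_nhdsNE_notMem_of_finite_inter_Icc {S : Set ℝ}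
    (hS : ∀ R : ℝ, (S ∩ Set.Icc (-R) R).Finite) (t : ℝ) : ∀ᶠ x in 𝓝[≠] t, x ∉ S := by
  have hfin : ((S ∩ Set.Icc (-(|t| + 1)) (|t| + 1)) \ {t}).Finite := (hS _).sdiff
  have hIcc : Set.Icc (-(|t| + 1)) (|t| + 1) ∈ 𝓝 t :=
    Icc_mem_nhds (by linarith [neg_abs_le t]) (by linarith [le_abs_self t])
  filter_upwards [mem_nhdsWithin_of_mem_nhds
    (hfin.isClosed.isOpen_compl.mem_nhds fun h => h.2 rfl), mem_nhdsWithin_of_mem_nhds hIcc,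
    self_mem_nhdsWithin] with x hx hxI hxt hxS
  exact hx ⟨⟨hxS, hxI⟩, hxt⟩

theorem countable_of_finite_inter_Icc {S : Set ℝ} (hS : ∀ R : ℝ, (S ∩ Set.Icc (-R) R).Finite) :
    S.Countable := by
  refine (Set.countable_iUnion fun n : ℕ => (hS n).countable).mono fun x hx => ?_
  obtain ⟨n, hn⟩ := exists_nat_ge |x|
  exact Set.mem_iUnion.2 ⟨n, hx, abs_le.1 hn⟩

namespace IsPiecewiseC1

variable {γ : ℝ → ℂ}

theorem locallyIntegrable_deriv (hγ : IsPiecewiseC1 γ) : LocallyIntegrable (deriv γ) := by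
  obtain ⟨-, S, hS, hC1⟩ := hγ
  intro t
  obtain ⟨δ, hδ, hball⟩ := Metric.mem_nhdsWithin_iff.1
    (eventually_nhdsNE_notMem_of_finite_inter_Icc hS t)
  have hnot : ∀ x, x ∈ Set.Ioo (t - δ) (t + δ) → x ≠ t → x ∉ S := fun x hx hxt =>
    hball ⟨(Real.ball_eq_Ioo t δ).symm ▸ hx, hxt⟩
  have hleft : ContDiffOn ℝ 1 γ (Set.Icc (t - δ) t) :=
    hC1 _ _ (by linarith) <| Set.disjoint_left.2 fun x hx =>
      hnot x ⟨hx.1, by linarith [hx.2]⟩ hx.2.ne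
  have hright : ContDiffOn ℝ 1 γ (Set.Icc t (t + δ)) :=
    hC1 _ _ (by linarith) <| Set.disjoint_left.2 fun x hx =>
      hnot x ⟨by linarith [hx.1], hx.2⟩ hx.1.ne'
  refine ⟨Set.Ioo (t - δ) (t + δ), Ioo_mem_nhds (by linarith) (by linarith), ?_⟩
  rw [← Set.Ioc_union_Ioo_eq_Ioo (by linarith : t - δ ≤ t) (by linarith : t < t + δ)]
  exact ((integrableOn_Ioc_iff_integrableOn_Ioo (by simp)).2
    (integrableOn_deriv_Ioo_of_contDiffOn_Icc (by linarith) hleft)).union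
    (integrableOn_deriv_Ioo_of_contDiffOn_Icc (by linarith) hright)

theorem exists_countable_differentiableAt (hγ : IsPiecewiseC1 γ) :
    ∃ S : Set ℝ, S.Countable ∧ ∀ t ∉ S, DifferentiableAt ℝ γ t := by
  obtain ⟨-, S, hS, hC1⟩ := hγ
  refine ⟨S, countable_of_finite_inter_Icc hS, fun t ht => ?_⟩
  have hev : ∀ᶠ x in 𝓝 t, x ∉ S :=
    eventually_nhdsWithin_iff.1 (eventually_nhdsNE_notMem_of_finite_inter_Icc hS t) |>.mono
      fun x hx hxS => hx (fun h => ht (h ▸ hxS)) hxS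
  obtain ⟨δ, hδ, hball⟩ := Metric.eventually_nhds_iff_ball.1 hev
  rw [Real.ball_eq_Ioo] at hball
  exact ((hC1 _ _ (by linarith) (Set.disjoint_left.2 hball)).differentiableOn
    one_ne_zero).differentiableAt (Icc_mem_nhds (by linarith) (by linarith))

theorem intervalIntegrable_mul_deriv (hγ : IsPiecewiseC1 γ) {f : ℂ → ℂ}
    (hf : Continuous fun t => f (γ t)) (u v : ℝ) :
    IntervalIntegrable (fun t => f (γ t) * deriv γ t) volume u v :=
  ((hγ.locallyIntegrable_deriv.integrableOn_isCompact
    isCompact_uIcc).intervalIntegrable).continuousOn_mul hf.continuousOn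

theorem hasContourIntegral_of_primitive (hγ : IsPiecewiseC1 γ) {P f : ℂ → ℂ} {A B : ℂ}
    (hP : ∀ t, HasDerivAt P (f (γ t)) (γ t)) (hf : Continuous fun t => f (γ t))
    (hbot : Tendsto (fun t => P (γ t)) atBot (𝓝 A))
    (htop : Tendsto (fun t => P (γ t)) atTop (𝓝 B)) :
    HasContourIntegral γ f (B - A) := by
  obtain ⟨S, hS, hγ'⟩ := hγ.exists_countable_differentiableAt
  refine ⟨hγ.intervalIntegrable_mul_deriv hf,
    ((htop.comp tendsto_snd).sub (hbot.comp tendsto_fst)).congr fun T => ?_⟩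
  have hcont : Continuous fun t => P (γ t) :=
    continuous_iff_continuousAt.2 fun t => (hP t).continuousAt.comp (f := γ) hγ.1.continuousAt
  exact (integral_eq_of_hasDerivAt_off_countable _ _ hS hcont.continuousOn
    (fun t ht => (hP t).comp t (hγ' t ht.2).hasDerivAt)
    (hγ.intervalIntegrable_mul_deriv hf _ _)).symm

end IsPiecewiseC1

end ContourIntegral

section VerticalPath

theorem hasDerivAt_inv_sub {p s : ℂ} (h : s ≠ p) :
    HasDerivAt (fun s => (s - p)⁻¹) (-((s - p)⁻¹) ^ 2) s := by
  simpa [div_eq_mul_inv] using ((hasDerivAt_id s).sub_const p).fun_inv (sub_ne_zero.2 h)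

namespace IsVerticalPath

variable {γ : ℝ → ℂ}

theorem tendsto_abs_im_cocompact (hγ : IsVerticalPath γ) :
    Tendsto (fun t => |(γ t).im|) (cocompact ℝ) atTop := by
  rw [cocompact_eq_atBot_atTop, tendsto_sup]
  exact ⟨tendsto_abs_atBot_atTop.comp hγ.tendsto_bot, tendsto_abs_atTop_atTop.comp hγ.tendsto_top⟩

theorem tendsto_cobounded (hγ : IsVerticalPath γ) :
    Tendsto γ (cocompact ℝ) (Bornology.cobounded ℂ) :=
  tendsto_norm_atTop_iff_cobounded.1 <|
    tendsto_atTop_mono (fun _ => Complex.abs_im_le_norm _) hγ.tendsto_abs_im_cocompact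

theorem isClosed_range (hγ : IsVerticalPath γ) : IsClosed (Set.range γ) := by
  have h : IsProperMap γ := isProperMap_iff_tendsto_cocompact.2
    ⟨hγ.piecewiseC1.1, Metric.cobounded_eq_cocompact (α := ℂ) ▸ hγ.tendsto_cobounded⟩
  exact h.isClosedMap.isClosed_range

theorem tendsto_inv_sub (hγ : IsVerticalPath γ) (p : ℂ) :
    Tendsto (fun t => (γ t - p)⁻¹) (cocompact ℝ) (𝓝 0) :=
  tendsto_inv₀_cobounded.comp ((tendsto_sub_const_cobounded p).comp hγ.tendsto_cobounded)

theorem continuous_inv_sub (hγ : IsVerticalPath γ) {p : ℂ} (hp : p ∉ Set.range γ) :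
    Continuous fun t => (γ t - p)⁻¹ :=
  (hγ.piecewiseC1.1.sub continuous_const).inv₀ fun t ht => hp ⟨t, sub_eq_zero.1 ht⟩

theorem hasContourIntegral_zero_of_tendsto_cocompact (hγ : IsVerticalPath γ) {P f : ℂ → ℂ} {A : ℂ}
    (hP : ∀ t, HasDerivAt P (f (γ t)) (γ t)) (hf : Continuous fun t => f (γ t))
    (h : Tendsto (fun t => P (γ t)) (cocompact ℝ) (𝓝 A)) : HasContourIntegral γ f 0 := by
  rw [cocompact_eq_atBot_atTop, tendsto_sup] at h
  simpa using hγ.piecewiseC1.hasContourIntegral_of_primitive hP hf h.1 h.2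

theorem hasContourIntegral_inv_sub_pow (hγ : IsVerticalPath γ) {p : ℂ} (hp : p ∉ Set.range γ)
    (k : ℕ) : HasContourIntegral γ (fun s => ((s - p)⁻¹) ^ (k + 2)) 0 := by
  refine hγ.hasContourIntegral_zero_of_tendsto_cocompact
    (P := fun s => -((k : ℂ) + 1)⁻¹ * ((s - p)⁻¹) ^ (k + 1)) (A := 0) (fun t => ?_)
    ((hγ.continuous_inv_sub hp).pow _) ?_
  · refine (((hasDerivAt_inv_sub fun h => hp ⟨t, h⟩).pow (k + 1)).const_mul _).congr_deriv ?_
    have : (k : ℂ) + 1 ≠ 0 := by exact_mod_cast k.succ_ne_zero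
    generalize (γ t - p)⁻¹ = x
    push_cast [Nat.add_sub_cancel]
    field_simp
    ring
  · simpa using ((hγ.tendsto_inv_sub p).pow (k + 1)).const_mul (-((k : ℂ) + 1)⁻¹)

/- A primitive is `log ((s - q) / (s - p))`; the quotient stays in the unit disc around `1`. -/
theorem hasContourIntegral_inv_sub_sub_inv_sub_of_norm_lt (hγ : IsVerticalPath γ) {p q : ℂ}
    (h : ∀ t, ‖p - q‖ < ‖γ t - p‖) :
    HasContourIntegral γ (fun s => (s - q)⁻¹ - (s - p)⁻¹) 0 := by
  have hp : ∀ t, γ t ≠ p := fun t =>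
    sub_ne_zero.1 (norm_pos_iff.1 ((norm_nonneg _).trans_lt (h t)))
  have hslit : ∀ t, 1 + (p - q) * (γ t - p)⁻¹ ∈ Complex.slitPlane := fun t => by
    refine Complex.mem_slitPlane_of_norm_lt_one ?_
    rw [norm_mul, norm_inv, ← div_eq_mul_inv, div_lt_one (norm_pos_iff.2 (sub_ne_zero.2 (hp t)))]
    exact h t
  have hquot : ∀ t, 1 + (p - q) * (γ t - p)⁻¹ = (γ t - q) * (γ t - p)⁻¹ := fun t => by
    have := sub_ne_zero.2 (hp t)
    field_simp
    ring
  have hq : ∀ t, γ t ≠ q := fun t ht =>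
    Complex.slitPlane_ne_zero (hslit t) (by rw [hquot, ht, sub_self, zero_mul])
  refine hγ.hasContourIntegral_zero_of_tendsto_cocompact
    (P := fun s => Complex.log (1 + (p - q) * (s - p)⁻¹)) (A := 0) (fun t => ?_) ?_ ?_
  · refine ((((hasDerivAt_inv_sub (hp t)).const_mul (p - q)).const_add 1).clog
      (hslit t)).congr_deriv ?_
    have := sub_ne_zero.2 (hp t)
    have := sub_ne_zero.2 (hq t)
    rw [hquot]
    field_simp
    ring
  · exact (hγ.continuous_inv_sub fun ⟨t, ht⟩ => hq t ht).sub
      (hγ.continuous_inv_sub fun ⟨t, ht⟩ => hp t ht)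
  · have hlim : Tendsto (fun t => 1 + (p - q) * (γ t - p)⁻¹) (cocompact ℝ) (𝓝 1) := by
      simpa using ((hγ.tendsto_inv_sub p).const_mul (p - q)).const_add 1
    simpa using hlim.clog Complex.one_mem_slitPlane

theorem hasContourIntegral_inv_sub_sub_inv_sub_of_joinedIn (hγ : IsVerticalPath γ) {p q : ℂ}
    (h : JoinedIn (Set.range γ)ᶜ p q) :
    HasContourIntegral γ (fun s => (s - p)⁻¹ - (s - q)⁻¹) 0 := by
  obtain ⟨ω, hω⟩ := h
  refine (isPreconnected_range ω.continuous).induction₂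
    (fun x y => HasContourIntegral γ (fun s => (s - x)⁻¹ - (s - y)⁻¹) 0)
    ?_ ?_ ?_ ⟨0, ω.source⟩ ⟨1, ω.target⟩
  · rintro _ ⟨r, rfl⟩
    obtain ⟨ε, hε, hball⟩ := Metric.mem_nhds_iff.1 (hγ.isClosed_range.isOpen_compl.mem_nhds (hω r))
    filter_upwards [mem_nhdsWithin_of_mem_nhds (Metric.ball_mem_nhds (ω r) hε)] with y hy
    have hnear : ∀ t, ‖ω r - y‖ < ‖γ t - ω r‖ := fun t => by
      have hε : ε ≤ dist (γ t) (ω r) := le_of_not_gt fun hlt => hball hlt ⟨t, rfl⟩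
      rw [← dist_eq_norm, ← dist_eq_norm, dist_comm (ω r)]
      exact (Metric.mem_ball.1 hy).trans_le hε
    simpa using (hγ.hasContourIntegral_inv_sub_sub_inv_sub_of_norm_lt hnear).neg
  · intro x y z _ _ _ hxy hyz
    simpa using hxy.add hyz
  · intro x y _ _ hxy
    simpa using hxy.neg

end IsVerticalPath

end VerticalPath

section Strip

/-- The open vertical strip of half-width `B` around the imaginary axis. -/
def verticalStrip (B : ℝ) : Set ℂ := {s | |s.re| < B}

/-- The filter of the points of `verticalStrip B` whose imaginary part tends to `∞`. -/
def stripTop (B : ℝ) : Filter ℂ := comap Complex.im atTop ⊓ 𝓟 (verticalStrip B)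

/-- The filter of the points of `verticalStrip B` whose imaginary part tends to `∞` or `-∞`. -/
def stripEnds (B : ℝ) : Filter ℂ := comap (fun s => |s.im|) atTop ⊓ 𝓟 (verticalStrip B)

variable {B : ℝ}

theorem isOpen_verticalStrip (B : ℝ) : IsOpen (verticalStrip B) :=
  isOpen_lt Complex.continuous_re.abs continuous_const

theorem convex_verticalStrip (B : ℝ) : Convex ℝ (verticalStrip B) := by
  have : verticalStrip B = Complex.reLm ⁻¹' Metric.ball 0 B := by
    ext s; simp [verticalStrip]
  rw [this]
  exact (convex_ball _ _).linear_preimage _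

theorem ofReal_mul_I_mem_verticalStrip (hB : 0 < B) (y : ℝ) : y * Complex.I ∈ verticalStrip B := by
  simpa [verticalStrip] using hB

theorem neg_mem_verticalStrip {s : ℂ} : -s ∈ verticalStrip B ↔ s ∈ verticalStrip B := by
  simp [verticalStrip]

theorem tendsto_stripTop_iff {α : Type*} {l : Filter α} {g : α → ℂ} :
    Tendsto g l (stripTop B) ↔
      Tendsto (fun x => (g x).im) l atTop ∧ ∀ᶠ x in l, g x ∈ verticalStrip B := by
  rw [stripTop, tendsto_inf, tendsto_comap_iff, tendsto_principal]
  rfl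

theorem tendsto_stripEnds_iff {α : Type*} {l : Filter α} {g : α → ℂ} :
    Tendsto g l (stripEnds B) ↔
      Tendsto (fun x => |(g x).im|) l atTop ∧ ∀ᶠ x in l, g x ∈ verticalStrip B := by
  rw [stripEnds, tendsto_inf, tendsto_comap_iff, tendsto_principal]
  rfl

theorem tendsto_abs_im_stripEnds (B : ℝ) : Tendsto (fun s => |s.im|) (stripEnds B) atTop :=
  (tendsto_stripEnds_iff.1 tendsto_id).1

theorem eventually_mem_verticalStrip (B : ℝ) : ∀ᶠ s in stripEnds B, s ∈ verticalStrip B :=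
  (tendsto_stripEnds_iff.1 tendsto_id).2

theorem stripTop_le_stripEnds (B : ℝ) : stripTop B ≤ stripEnds B :=
  have h := tendsto_stripTop_iff.1 (tendsto_id (x := stripTop B))
  tendsto_id'.1 (tendsto_stripEnds_iff.2 ⟨tendsto_abs_atTop_atTop.comp h.1, h.2⟩)

theorem tendsto_neg_stripEnds (B : ℝ) : Tendsto (fun s => -s) (stripEnds B) (stripEnds B) :=
  tendsto_stripEnds_iff.2 ⟨by simpa using tendsto_abs_im_stripEnds B, by
    simpa only [neg_mem_verticalStrip] using eventually_mem_verticalStrip B⟩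

theorem eventually_stripTop_iff {p : ℂ → Prop} :
    (∀ᶠ s in stripTop B, p s) ↔ ∃ M : ℝ, ∀ s ∈ verticalStrip B, M ≤ s.im → p s := by
  rw [stripTop, ((atTop_basis.comap Complex.im).inf_principal _).eventually_iff]
  simp only [true_and, Set.mem_inter_iff, Set.mem_preimage, Set.mem_Ici]
  exact exists_congr fun M => forall_congr' fun s => by tauto

theorem eventually_ne_stripEnds (B : ℝ) (p : ℂ) : ∀ᶠ s in stripEnds B, s ≠ p := by
  filter_upwards [(tendsto_abs_im_stripEnds B).eventually_gt_atTop |p.im|] with s hs hsp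
  exact hs.ne' (by rw [hsp])

theorem inv_sub_isBigO_stripEnds (B : ℝ) (p : ℂ) :
    (fun s => (s - p)⁻¹) =O[stripEnds B] fun s => (s.im)⁻¹ := by
  refine Asymptotics.IsBigO.of_bound 2 ?_
  filter_upwards [(tendsto_abs_im_stripEnds B).eventually_ge_atTop (2 * |p.im| + 1)] with s hs
  have hdist : |s.im| - |p.im| ≤ ‖s - p‖ :=
    (abs_sub_abs_le_abs_sub _ _).trans (by simpa using Complex.abs_im_le_norm (s - p))
  have hp := abs_nonneg p.im
  rw [norm_inv, norm_inv, Real.norm_eq_abs]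
  calc ‖s - p‖⁻¹ ≤ (|s.im| / 2)⁻¹ := inv_anti₀ (by linarith) (by linarith)
    _ = 2 * |s.im|⁻¹ := by rw [inv_div, div_eq_mul_inv]

theorem inv_sub_pow_isBigO_stripEnds (B : ℝ) (p : ℂ) (k : ℕ) :
    (fun s => ((s - p)⁻¹) ^ (k + 2)) =O[stripEnds B] fun s => (s.im ^ 2)⁻¹ := by
  refine ((inv_sub_isBigO_stripEnds B p).pow (k + 2)).trans (Asymptotics.IsBigO.of_bound 1 ?_)
  filter_upwards [(tendsto_abs_im_stripEnds B).eventually_ge_atTop 1] with s hs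
  rw [one_mul, norm_pow, norm_inv, norm_inv, norm_pow, Real.norm_eq_abs, pow_add, inv_pow, inv_pow]
  exact mul_le_of_le_one_left (by positivity) (inv_le_one_of_one_le₀ (one_le_pow₀ hs))

theorem inv_sub_sub_inv_sub_isBigO_stripEnds (B : ℝ) (p q : ℂ) :
    (fun s => (s - p)⁻¹ - (s - q)⁻¹) =O[stripEnds B] fun s => (s.im ^ 2)⁻¹ := by
  have h := ((inv_sub_isBigO_stripEnds B p).mul (inv_sub_isBigO_stripEnds B q)).const_mul_left
    (p - q)
  refine h.congr' ?_ (.of_forall fun s => by simp only [← mul_inv, sq])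
  filter_upwards [eventually_ne_stripEnds B p, eventually_ne_stripEnds B q] with s hp hq
  rw [← mul_assoc, inv_sub_inv (sub_ne_zero.2 hp) (sub_ne_zero.2 hq), sub_sub_sub_cancel_left,
    div_eq_mul_inv, mul_inv, mul_assoc]


section Primitive

variable {P f : ℂ → ℂ}

theorem tendsto_ofReal_mul_I_stripTop (hB : 0 < B) :
    Tendsto (fun y : ℝ => y * Complex.I) atTop (stripTop B) :=
  tendsto_stripTop_iff.2 ⟨tendsto_id.congr fun y => by simp,
    .of_forall (ofReal_mul_I_mem_verticalStrip hB)⟩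

theorem exists_tendsto_primitive_ofReal_mul_I (hB : 0 < B)
    (hP : ∀ s ∈ verticalStrip B, HasDerivAt P (f s) s) (hf : ContinuousOn f (verticalStrip B))
    (hdec : f =O[stripTop B] fun s => (s.im ^ 2)⁻¹) :
    ∃ L, Tendsto (fun y : ℝ => P (y * Complex.I)) atTop (𝓝 L) := by
  have hmem := ofReal_mul_I_mem_verticalStrip hB
  have hderiv (y : ℝ) : HasDerivAt (fun y : ℝ => P (y * Complex.I))
      (f (y * Complex.I) * Complex.I) y := by
    have := (Complex.ofRealCLM.hasDerivAt (x := y)).mul_const Complex.I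
    exact ((hP _ (hmem y)).comp y (by simpa using this) :)
  have hcont : Continuous fun y : ℝ => f (y * Complex.I) * Complex.I :=
    (hf.comp_continuous (by fun_prop) hmem).mul continuous_const
  have hO : (fun y : ℝ => f (y * Complex.I) * Complex.I) =O[atTop] fun y => y ^ (-2 : ℝ) := by
    refine (((hdec.comp_tendsto (tendsto_ofReal_mul_I_stripTop hB)).mul
      (Asymptotics.isBigO_const_const Complex.I one_ne_zero _)).congr_right fun y => ?_)
    norm_cast
    simp
  have hint : IntegrableOn (fun y : ℝ => f (y * Complex.I) * Complex.I) (Set.Ici 0) :=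
    (hcont.locallyIntegrable.locallyIntegrableOn _).integrableOn_of_isBigO_atTop hO
      (integrableAtFilter_rpow_atTop_iff.2 (by norm_num))
  exact ⟨_, tendsto_limUnder_of_hasDerivAt_of_integrableOn_Ioi (fun y _ => hderiv y)
    (hint.mono_set Set.Ioi_subset_Ici_self)⟩

theorem tendsto_primitive_sub_primitive_im_mul_I
    (hP : ∀ s ∈ verticalStrip B, HasDerivAt P (f s) s)
    (hdec : f =O[stripTop B] fun s => (s.im ^ 2)⁻¹) :
    Tendsto (fun s => P s - P (s.im * Complex.I)) (stripTop B) (𝓝 0) := by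
  obtain ⟨C, hC0, hC⟩ := hdec.exists_pos
  obtain ⟨M, hM⟩ := eventually_stripTop_iff.1 hC.bound
  have hsmall : Tendsto (fun s : ℂ => C * (s.im ^ 2)⁻¹ * B) (stripTop B) (𝓝 0) := by
    have him : Tendsto Complex.im (stripTop B) atTop := (tendsto_stripTop_iff.1 tendsto_id).1
    simpa using ((tendsto_inv_atTop_zero.comp
      ((tendsto_pow_atTop two_ne_zero).comp him)).const_mul C).mul_const B
  refine squeeze_zero_norm' (eventually_stripTop_iff.2 ⟨M, fun s hs him => ?_⟩) hsmall
  have hB : 0 < B := (abs_nonneg _).trans_lt hs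
  have hconv := (convex_verticalStrip B).inter
    ((convex_halfSpace_im_ge s.im).inter (convex_halfSpace_im_le s.im))
  have hbound : ∀ w ∈ verticalStrip B ∩ ({w | s.im ≤ w.im} ∩ {w | w.im ≤ s.im}),
      ‖f w‖ ≤ C * (s.im ^ 2)⁻¹ := fun w hw => by
    have hw' : w.im = s.im := le_antisymm hw.2.2 hw.2.1
    simpa [hw'] using hM w hw.1 (hw' ▸ him)
  have hre : s - s.im * Complex.I = s.re := by
    rw [sub_eq_iff_eq_add, Complex.re_add_im]
  calc ‖P s - P (s.im * Complex.I)‖ ≤ C * (s.im ^ 2)⁻¹ * ‖s - s.im * Complex.I‖ :=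
        hconv.norm_image_sub_le_of_norm_hasDerivWithin_le
          (fun w hw => (hP w hw.1).hasDerivWithinAt) hbound
          ⟨ofReal_mul_I_mem_verticalStrip hB _, by simp⟩ ⟨hs, by simp⟩
    _ ≤ C * (s.im ^ 2)⁻¹ * B := by
        rw [hre, Complex.norm_real, Real.norm_eq_abs]
        exact mul_le_mul_of_nonneg_left (le_of_lt hs) (by positivity)

theorem exists_tendsto_primitive_stripTop (hB : 0 < B)
    (hP : ∀ s ∈ verticalStrip B, HasDerivAt P (f s) s) (hf : ContinuousOn f (verticalStrip B))
    (hdec : f =O[stripTop B] fun s => (s.im ^ 2)⁻¹) :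
    ∃ L, Tendsto P (stripTop B) (𝓝 L) := by
  obtain ⟨L, hL⟩ := exists_tendsto_primitive_ofReal_mul_I hB hP hf hdec
  have him : Tendsto Complex.im (stripTop B) atTop := (tendsto_stripTop_iff.1 tendsto_id).1
  exact ⟨L, by simpa using (tendsto_primitive_sub_primitive_im_mul_I hP hdec).add (hL.comp him)⟩

theorem exists_forall_hasContourIntegral_of_differentiableOn
    (hf : DifferentiableOn ℂ f (verticalStrip B))
    (hdec : f =O[stripEnds B] fun s => (s.im ^ 2)⁻¹) :
    ∃ J, ∀ γ, IsVerticalPath γ → (∀ t, γ t ∈ verticalStrip B) → HasContourIntegral γ f J := by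
  rcases le_or_gt B 0 with hB | hB
  · exact ⟨0, fun γ _ hγ => absurd (hγ 0) (not_lt.2 (hB.trans (abs_nonneg _)))⟩
  obtain ⟨P, hP'⟩ := (convex_verticalStrip B).exists_forall_hasDerivWithinAt hf
  have hP : ∀ s ∈ verticalStrip B, HasDerivAt P (f s) s := fun s hs =>
    (hP' s hs).hasDerivAt ((isOpen_verticalStrip B).mem_nhds hs)
  have hneg : ∀ s ∈ verticalStrip B, HasDerivAt (fun s => P (-s)) (-f (-s)) s := fun s hs =>
    ((hP _ (neg_mem_verticalStrip.2 hs)).comp s (hasDerivAt_neg s)).congr_deriv (by simp)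
  have hdec_neg : (fun s => -f (-s)) =O[stripTop B] fun s => (s.im ^ 2)⁻¹ := by
    simpa [Function.comp_def] using
      ((hdec.comp_tendsto (tendsto_neg_stripEnds B)).neg_left).mono (stripTop_le_stripEnds B)
  obtain ⟨L₁, h₁⟩ := exists_tendsto_primitive_stripTop hB hP hf.continuousOn
    (hdec.mono (stripTop_le_stripEnds B))
  obtain ⟨L₂, h₂⟩ := exists_tendsto_primitive_stripTop hB hneg
    (hf.continuousOn.comp continuousOn_neg fun s hs => neg_mem_verticalStrip.2 hs).neg hdec_neg
  refine ⟨L₁ - L₂, fun γ hγ hγB => hγ.piecewiseC1.hasContourIntegral_of_primitive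
    (fun t => hP _ (hγB t)) (hf.continuousOn.comp_continuous hγ.piecewiseC1.1 hγB) ?_
    (h₁.comp (tendsto_stripTop_iff.2 ⟨hγ.tendsto_top, .of_forall hγB⟩))⟩
  have hbot : Tendsto (fun t => -γ t) atBot (stripTop B) := tendsto_stripTop_iff.2
    ⟨by simpa using hγ.tendsto_bot, .of_forall fun t => neg_mem_verticalStrip.2 (hγB t)⟩
  simpa [Function.comp_def] using h₂.comp hbot

end Primitive

end Strip

section ElementaryFraction

/-- The functions `(s - p)⁻¹ - (s - q)⁻¹`, `(s - p)⁻²`, `(s - p)⁻³`, …: a basis for the principal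
parts at `p`, with the simple pole compensated at `q` so that all of them decay quadratically. -/
noncomputable def elementaryFraction (p q : ℂ) (k : ℕ) (s : ℂ) : ℂ :=
  ((s - p)⁻¹) ^ (k + 1) - if k = 0 then (s - q)⁻¹ else 0

variable {p q : ℂ}

theorem elementaryFraction_isBigO_stripEnds (B : ℝ) (p q : ℂ) (k : ℕ) :
    elementaryFraction p q k =O[stripEnds B] fun s => (s.im ^ 2)⁻¹ := by
  unfold elementaryFraction
  rcases k with _ | k
  · simpa using inv_sub_sub_inv_sub_isBigO_stripEnds B p q
  · simpa using inv_sub_pow_isBigO_stripEnds B p k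

theorem IsVerticalPath.hasContourIntegral_elementaryFraction {γ : ℝ → ℂ} (hγ : IsVerticalPath γ)
    (h : JoinedIn (Set.range γ)ᶜ p q) (k : ℕ) :
    HasContourIntegral γ (elementaryFraction p q k) 0 := by
  unfold elementaryFraction
  rcases k with _ | k
  · simpa using hγ.hasContourIntegral_inv_sub_sub_inv_sub_of_joinedIn h
  · simpa using hγ.hasContourIntegral_inv_sub_pow h.source_mem k

theorem analyticAt_elementaryFraction {s : ℂ} (hp : s ≠ p) (hq : s ≠ q) (k : ℕ) :
    AnalyticAt ℂ (elementaryFraction p q k) s := by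
  have hinv : ∀ r, s ≠ r → AnalyticAt ℂ (fun s => (s - r)⁻¹) s := fun r hr =>
    (analyticAt_id.sub analyticAt_const).fun_inv (sub_ne_zero.2 hr)
  unfold elementaryFraction
  split_ifs
  · exact ((hinv p hp).pow _).sub (hinv q hq)
  · exact ((hinv p hp).pow _).sub analyticAt_const

theorem meromorphicAt_elementaryFraction (p q : ℂ) (k : ℕ) (s : ℂ) :
    MeromorphicAt (elementaryFraction p q k) s := by
  unfold elementaryFraction
  split_ifs <;> fun_prop

theorem exists_eq_sum_inv_sub_pow_add (n : ℕ) {h : ℂ → ℂ} (hh : AnalyticAt ℂ h p) :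
    ∃ (c : ℕ → ℂ) (φ : ℂ → ℂ), AnalyticAt ℂ φ p ∧ ∀ s ≠ p,
      ((s - p)⁻¹) ^ n * h s = ∑ k ∈ Finset.range n, c k * ((s - p)⁻¹) ^ (k + 1) + φ s := by
  induction n generalizing h with
  | zero => exact ⟨0, h, hh, fun s _ => by simp⟩
  | succ n ih =>
    obtain ⟨P, hP⟩ := hh
    obtain ⟨c, φ, hφ, hc⟩ := ih ⟨_, hP.has_fpower_series_dslope_fslope⟩
    refine ⟨Function.update c n (h p), φ, hφ, fun s hs => ?_⟩
    have hsum : ∑ k ∈ Finset.range n, Function.update c n (h p) k * ((s - p)⁻¹) ^ (k + 1) =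
        ∑ k ∈ Finset.range n, c k * ((s - p)⁻¹) ^ (k + 1) :=
      Finset.sum_congr rfl fun k hk => by
        rw [Function.update_of_ne (Finset.mem_range.1 hk).ne]
    have hdslope : h s = h p + (s - p) * dslope h p s := by
      rw [← smul_eq_mul, sub_smul_dslope]; ring
    rw [Finset.sum_range_succ, hsum, Function.update_self, add_right_comm, ← hc s hs, hdslope]
    linear_combination (((s - p)⁻¹) ^ n * dslope h p s) * mul_inv_cancel₀ (sub_ne_zero.2 hs)

theorem exists_eq_sum_elementaryFraction_add {f : ℂ → ℂ} (hf : MeromorphicAt f p) (hpq : p ≠ q) :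
    ∃ (n : ℕ) (c : ℕ → ℂ) (ψ : ℂ → ℂ), AnalyticAt ℂ ψ p ∧ ∀ s ≠ p,
      f s = ∑ k ∈ Finset.range n, c k * elementaryFraction p q k s + ψ s := by
  obtain ⟨n, hn⟩ := hf
  obtain ⟨c, φ, hφ, h⟩ := exists_eq_sum_inv_sub_pow_add n hn
  refine ⟨n, c, fun s => φ s + ∑ k ∈ Finset.range n, c k * (if k = 0 then (s - q)⁻¹ else 0),
    hφ.add (Finset.analyticAt_fun_sum _ fun k _ => analyticAt_const.mul ?_), fun s hs => ?_⟩
  · split_ifs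
    · exact (analyticAt_id.sub analyticAt_const).fun_inv (sub_ne_zero.2 hpq)
    · exact analyticAt_const
  · have hf : f s = ((s - p)⁻¹) ^ n * ((s - p) ^ n • f s) := by
      rw [smul_eq_mul, ← mul_assoc, ← mul_pow, inv_mul_cancel₀ (sub_ne_zero.2 hs), one_pow, one_mul]
    rw [hf, h s hs]
    simp only [elementaryFraction, mul_sub, Finset.sum_sub_distrib]
    ring

end ElementaryFraction

section Separates

/-- `γ` is a path from `-i∞` to `i∞` with the points of `X` on its left and the points of `Y` on
its right. -/
structure Separates (X Y : Set ℂ) (γ : ℝ → ℂ) : Prop where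
  vertical : IsVerticalPath γ
  left : ∀ p ∈ X, LiesLeft γ p
  right : ∀ p ∈ Y, LiesRight γ p

variable {B : ℝ} {X Y : Set ℂ} {γ : ℝ → ℂ} {p : ℂ}

theorem LiesLeft.notMem_range (h : LiesLeft γ p) : p ∉ Set.range γ :=
  h.exists.choose_spec.source_mem

theorem LiesRight.notMem_range (h : LiesRight γ p) : p ∉ Set.range γ :=
  h.exists.choose_spec.source_mem

theorem LiesLeft.joinedIn (hγ : ∀ t, γ t ∈ verticalStrip B) (hp : LiesLeft γ p) :
    JoinedIn (Set.range γ)ᶜ p (-(B : ℂ)) := by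
  obtain ⟨x, hx, hxB⟩ := (hp.and (eventually_ge_atTop B)).exists
  refine hx.trans (JoinedIn.of_segment_subset (((convex_halfSpace_re_le (-B)).segment_subset
    (by simpa using hxB) (by simp)).trans ?_))
  rintro _ hs ⟨t, rfl⟩
  have hre : (γ t).re ≤ -B := hs
  exact (neg_lt_of_abs_lt (hγ t)).not_ge hre

theorem LiesRight.joinedIn (hγ : ∀ t, γ t ∈ verticalStrip B) (hp : LiesRight γ p) :
    JoinedIn (Set.range γ)ᶜ p B := by
  obtain ⟨x, hx, hxB⟩ := (hp.and (eventually_ge_atTop B)).exists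
  refine hx.trans (JoinedIn.of_segment_subset (((convex_halfSpace_re_ge B).segment_subset
    (by simpa using hxB) (by simp)).trans ?_))
  rintro _ hs ⟨t, rfl⟩
  have hre : B ≤ (γ t).re := hs
  exact (lt_of_abs_lt (hγ t)).not_ge hre

theorem exists_notMem_verticalStrip_joinedIn (hp : p ∈ X ∪ Y) :
    ∃ q ∉ verticalStrip B, ∀ γ, Separates X Y γ → (∀ t, γ t ∈ verticalStrip B) →
      JoinedIn (Set.range γ)ᶜ p q := by
  rcases hp with hp | hp
  · exact ⟨-B, by simp [verticalStrip, le_abs_self], fun γ hγ hB => (hγ.left p hp).joinedIn hB⟩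
  · exact ⟨B, by simp [verticalStrip, le_abs_self], fun γ hγ hB => (hγ.right p hp).joinedIn hB⟩

theorem exists_eq_sum_elementaryFraction_add_of_isBigO {q : ℂ} {f : ℂ → ℂ}
    (hmer : ∀ s, MeromorphicAt f s) (hp : p ∈ verticalStrip B) (hq : q ∉ verticalStrip B)
    (hdec : f =O[stripEnds B] fun s => (s.im ^ 2)⁻¹) :
    ∃ (n : ℕ) (c : ℕ → ℂ) (ψ : ℂ → ℂ),
      (∀ s ≠ p, f s = ∑ k ∈ Finset.range n, c k * elementaryFraction p q k s + ψ s) ∧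
      (∀ s, MeromorphicAt ψ s) ∧
      (∀ s ∈ verticalStrip B, (s ≠ p → DifferentiableAt ℂ f s) → DifferentiableAt ℂ ψ s) ∧
      ψ =O[stripEnds B] fun s => (s.im ^ 2)⁻¹ := by
  have hstrip : ∀ s ∈ verticalStrip B, s ≠ q := fun s hs h => hq (h ▸ hs)
  obtain ⟨n, c, ψ, hψp, hψ⟩ := exists_eq_sum_elementaryFraction_add (hmer p) (hstrip p hp)
  set g : ℂ → ℂ := fun s => ∑ k ∈ Finset.range n, c k * elementaryFraction p q k s
  have hψfg : ∀ s ≠ p, f s - g s = ψ s := fun s hs => sub_eq_iff_eq_add'.2 (hψ s hs)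
  have hgmer : ∀ s, MeromorphicAt g s := fun s => MeromorphicAt.fun_sum fun k _ =>
    (MeromorphicAt.const (c k) s).mul (meromorphicAt_elementaryFraction p q k s)
  have hgdiff : ∀ s ∈ verticalStrip B, s ≠ p → DifferentiableAt ℂ g s := fun s hs hsp =>
    DifferentiableAt.fun_sum fun k _ =>
      ((analyticAt_elementaryFraction hsp (hstrip s hs) k).differentiableAt.const_mul (c k))
  have hgO : g =O[stripEnds B] fun s => (s.im ^ 2)⁻¹ := Asymptotics.IsBigO.fun_sum fun k _ =>
    (elementaryFraction_isBigO_stripEnds B p q k).const_mul_left (c k)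
  refine ⟨n, c, ψ, hψ, fun s => ((hmer s).sub (hgmer s)).congr ?_, fun s hs hfs => ?_,
    (hdec.sub hgO).congr' ((eventually_ne_stripEnds B p).mono hψfg) .rfl⟩
  · filter_upwards [nhdsNE_le_cofinite s (eventually_cofinite_ne p)] with r hr using hψfg r hr
  · rcases eq_or_ne s p with rfl | hsp
    · exact hψp.differentiableAt
    · refine ((hfs hsp).sub (hgdiff s hs hsp)).congr_of_eventuallyEq ?_
      filter_upwards [isOpen_ne.mem_nhds hsp] with r hr using (hψfg r hr).symm

theorem exists_forall_hasContourIntegral_of_finset (D : Finset ℂ) (hDXY : ∀ p ∈ D, p ∈ X ∪ Y)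
    (hDB : ∀ p ∈ D, p ∈ verticalStrip B) {f : ℂ → ℂ} (hmer : ∀ s, MeromorphicAt f s)
    (hf : ∀ s ∈ verticalStrip B, s ∉ D → DifferentiableAt ℂ f s)
    (hdec : f =O[stripEnds B] fun s => (s.im ^ 2)⁻¹) :
    ∃ J, ∀ γ, Separates X Y γ → (∀ t, γ t ∈ verticalStrip B) → HasContourIntegral γ f J := by
  classical
  induction D using Finset.induction_on generalizing f with
  | empty =>
    obtain ⟨J, hJ⟩ := exists_forall_hasContourIntegral_of_differentiableOn
      (fun s hs => (hf s hs (by simp)).differentiableWithinAt) hdec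
    exact ⟨J, fun γ hγ => hJ γ hγ.vertical⟩
  | insert p D _ ih =>
    rw [Finset.forall_mem_insert] at hDXY hDB
    obtain ⟨q, hqB, hq⟩ := exists_notMem_verticalStrip_joinedIn (B := B) hDXY.1
    obtain ⟨n, c, ψ, hψ, hψmer, hψdiff, hψdec⟩ :=
      exists_eq_sum_elementaryFraction_add_of_isBigO hmer hDB.1 hqB hdec
    obtain ⟨J, hJ⟩ := ih hDXY.2 hDB.2 hψmer
      (fun s hs hsD => hψdiff s hs fun hsp => hf s hs (by simp [hsp, hsD])) hψdec
    refine ⟨J, fun γ hγ hγB => ?_⟩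
    have hfractions : HasContourIntegral γ
        (fun s => ∑ k ∈ Finset.range n, c k * elementaryFraction p q k s) 0 := by
      simpa using HasContourIntegral.sum (Finset.range n) fun k _ =>
        (hγ.vertical.hasContourIntegral_elementaryFraction (hq γ hγ hγB) k).const_mul (c k)
    have hp : ∀ t, γ t ≠ p := fun t h => (hq γ hγ hγB).source_mem ⟨t, h⟩
    simpa using (hfractions.add (hJ γ hγ hγB)).congr fun t => (hψ (γ t) (hp t)).symm

namespace Separates

theorem mono {X' Y' : Set ℂ} (h : Separates X Y γ) (hX : X' ⊆ X) (hY : Y' ⊆ Y) :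
    Separates X' Y' γ :=
  ⟨h.vertical, fun p hp => h.left p (hX hp), fun p hp => h.right p (hY hp)⟩

theorem notMem_union (h : Separates X Y γ) (t : ℝ) : γ t ∉ X ∪ Y := by
  rintro (ht | ht)
  · exact (h.left _ ht).notMem_range ⟨t, rfl⟩
  · exact (h.right _ ht).notMem_range ⟨t, rfl⟩

end Separates

theorem exists_forall_separates_hasContourIntegral {f : ℂ → ℂ} (hmer : ∀ s, MeromorphicAt f s)
    (hf : ∀ s ∉ X ∪ Y, DifferentiableAt ℂ f s)
    (hfin : ∀ B, ((X ∪ Y) ∩ verticalStrip B).Finite)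
    (hdec : ∀ B, f =O[stripEnds B] fun s => (s.im ^ 2)⁻¹) :
    ∃ J, ∀ γ, Separates X Y γ → HasContourIntegral γ f J := by
  have hstrip (B : ℝ) : ∃ J, ∀ γ, Separates X Y γ → (∀ t, γ t ∈ verticalStrip B) →
      HasContourIntegral γ f J :=
    exists_forall_hasContourIntegral_of_finset (hfin B).toFinset
      (fun p hp => ((hfin B).mem_toFinset.1 hp).1) (fun p hp => ((hfin B).mem_toFinset.1 hp).2) hmer
      (fun s hs hsD => hf s fun h => hsD ((hfin B).mem_toFinset.2 ⟨h, hs⟩)) (hdec B)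
  choose J hJ using hstrip
  by_cases hne : ∃ γ, Separates X Y γ
  · obtain ⟨γ₁, h₁⟩ := hne
    obtain ⟨B₁, hB₁⟩ := h₁.vertical.bounded_re
    refine ⟨J (B₁ + 1), fun γ h => ?_⟩
    obtain ⟨B, hB⟩ := h.vertical.bounded_re
    set B' := max B₁ B + 1
    rw [(hJ _ γ₁ h₁ fun t => (hB₁ t).trans_lt (lt_add_one _)).unique (hJ B' γ₁ h₁ fun t =>
      ((hB₁ t).trans (le_max_left _ _)).trans_lt (lt_add_one _))]
    exact hJ B' γ h fun t => ((hB t).trans (le_max_right _ _)).trans_lt (lt_add_one _)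
  · exact ⟨0, fun γ h => (hne ⟨γ, h⟩).elim⟩

end Separates

section GammaDecay

open Complex

theorem aestronglyMeasurable_cpow_mul_cexp_neg_mul (a r : ℂ) :
    AEStronglyMeasurable (fun t : ℝ => (t : ℂ) ^ (a - 1) * cexp (-(r * t)))
      (volume.restrict (Set.Ioi 0)) := by
  refine ContinuousOn.aestronglyMeasurable (.mul (fun t ht => ?_) (by fun_prop)) measurableSet_Ioi
  exact (continuousAt_ofReal_cpow_const _ _ (.inr (ne_of_gt ht))).continuousWithinAt

theorem norm_cpow_mul_cexp_neg_mul (a r : ℂ) {t : ℝ} (ht : 0 < t) :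
    ‖(t : ℂ) ^ (a - 1) * cexp (-(r * t))‖ = t ^ (a.re - 1) * Real.exp (-(r.re * t)) := by
  rw [norm_mul, norm_cpow_eq_rpow_re_of_pos ht, norm_exp]
  simp

theorem integrableOn_cpow_mul_cexp_neg_mul {a r : ℂ} (ha : 0 < a.re) (hr : 0 < r.re) :
    IntegrableOn (fun t : ℝ => (t : ℂ) ^ (a - 1) * cexp (-(r * t))) (Set.Ioi 0) := by
  have h := integrableOn_rpow_mul_exp_neg_mul_rpow (s := a.re - 1) (p := 1) (by linarith) one_pos hr
  refine Integrable.mono' h (aestronglyMeasurable_cpow_mul_cexp_neg_mul a r) ?_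
  refine (ae_restrict_iff' measurableSet_Ioi).2 (.of_forall fun t ht => ?_)
  rw [norm_cpow_mul_cexp_neg_mul a r ht, Real.rpow_one, neg_mul]

theorem differentiableAt_integral_cpow_mul_cexp_neg_mul {a r₀ : ℂ} (ha : 0 < a.re)
    (hr : 0 < r₀.re) :
    DifferentiableAt ℂ (fun r : ℂ => ∫ t : ℝ in Set.Ioi 0, (t : ℂ) ^ (a - 1) * cexp (-(r * t)))
      r₀ := by
  have hnhds : {r : ℂ | r₀.re / 2 < r.re} ∈ 𝓝 r₀ :=
    (isOpen_lt continuous_const continuous_re).mem_nhds (half_lt_self hr)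
  have hderiv (t : ℝ) (ht : 0 < t) (r : ℂ) :
      HasDerivAt (fun r : ℂ => (t : ℂ) ^ (a - 1) * cexp (-(r * t)))
        (-((t : ℂ) ^ (a + 1 - 1) * cexp (-(r * t)))) r := by
    have hexp : HasDerivAt (fun r : ℂ => cexp (-(r * t))) (cexp (-(r * t)) * -(1 * t)) r :=
      ((hasDerivAt_id r).mul_const (t : ℂ)).neg.cexp
    refine (hexp.const_mul _).congr_deriv ?_
    rw [add_sub_right_comm, cpow_add _ _ (ofReal_ne_zero.2 ht.ne'), cpow_one]
    ring
  have hbound : IntegrableOn (fun t : ℝ => t ^ a.re * Real.exp (-(r₀.re / 2) * t)) (Set.Ioi 0) := by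
    simpa only [Real.rpow_one] using integrableOn_rpow_mul_exp_neg_mul_rpow (s := a.re) (p := 1)
      (b := r₀.re / 2) (by linarith) one_pos (half_pos hr)
  refine (hasDerivAt_integral_of_dominated_loc_of_deriv_le
    (F' := fun r t => -((t : ℂ) ^ (a + 1 - 1) * cexp (-(r * t)))) hnhds
    (.of_forall fun r => aestronglyMeasurable_cpow_mul_cexp_neg_mul a r)
    (integrableOn_cpow_mul_cexp_neg_mul ha hr)
    (aestronglyMeasurable_cpow_mul_cexp_neg_mul (a + 1) r₀).neg ?_ hbound ?_).2.differentiableAt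
  · refine (ae_restrict_iff' measurableSet_Ioi).2 (.of_forall fun t ht r hr' => ?_)
    have ht0 : (0 : ℝ) < t := ht
    have hr'' : r₀.re / 2 < r.re := hr'
    rw [norm_neg, norm_cpow_mul_cexp_neg_mul _ _ ht0, add_re, one_re,
      add_sub_cancel_right, neg_mul]
    gcongr
  · exact (ae_restrict_iff' measurableSet_Ioi).2 (.of_forall fun t ht r _ => hderiv t ht r)

theorem integral_cpow_mul_cexp_neg_mul {a r : ℂ} (ha : 0 < a.re) (hr : 0 < r.re) :
    ∫ t : ℝ in Set.Ioi 0, (t : ℂ) ^ (a - 1) * cexp (-(r * t)) = r ^ (-a) * Gamma a := by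
  have hopen : IsOpen {r : ℂ | 0 < r.re} := isOpen_lt continuous_const continuous_re
  have hleft : AnalyticOnNhd ℂ
      (fun r : ℂ => ∫ t : ℝ in Set.Ioi 0, (t : ℂ) ^ (a - 1) * cexp (-(r * t))) {r | 0 < r.re} :=
    DifferentiableOn.analyticOnNhd (fun r hr =>
      (differentiableAt_integral_cpow_mul_cexp_neg_mul ha hr).differentiableWithinAt) hopen
  have hright : AnalyticOnNhd ℂ (fun r : ℂ => r ^ (-a) * Gamma a) {r | 0 < r.re} :=
    DifferentiableOn.analyticOnNhd (fun r hr =>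
      ((differentiableAt_id.cpow_const (.inl hr)).mul_const _).differentiableWithinAt) hopen
  have hreal : ∀ᶠ x : ℝ in 𝓝[≠] 1,
      ∫ t : ℝ in Set.Ioi 0, (t : ℂ) ^ (a - 1) * cexp (-(x * t)) = (x : ℂ) ^ (-a) * Gamma a := by
    filter_upwards [mem_nhdsWithin_of_mem_nhds (Ioi_mem_nhds one_pos)] with x hx
    rw [integral_cpow_mul_exp_neg_mul_Ioi ha hx, one_div, inv_cpow, cpow_neg]
    rw [arg_ofReal_of_nonneg (le_of_lt hx)]
    exact Real.pi_pos.ne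
  have hofReal : Tendsto (fun x : ℝ => (x : ℂ)) (𝓝[≠] 1) (𝓝[≠] 1) :=
    ofReal_one ▸ continuous_ofReal.continuousWithinAt.tendsto_nhdsWithin
      fun x hx => fun h => hx (ofReal_injective h)
  exact hleft.eqOn_of_preconnected_of_frequently_eq hright
    (convex_halfSpace_re_gt 0).isPreconnected (z₀ := 1) (by simp)
    (hofReal.frequently hreal.frequently) hr

theorem norm_Gamma_mul_exp_le {s : ℂ} {θ : ℝ} (hs : 0 < s.re) (hθ : |θ| < Real.pi / 2) :
    ‖Gamma s‖ * Real.exp (θ * s.im) ≤ (1 / Real.cos θ) ^ s.re * Real.Gamma s.re := by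
  obtain ⟨hθ₁, hθ₂⟩ := abs_lt.1 hθ
  have hcos : 0 < Real.cos θ := Real.cos_pos_of_mem_Ioo ⟨hθ₁, hθ₂⟩
  have hre : (cexp (θ * I)).re = Real.cos θ := exp_ofReal_mul_I_re θ
  have hlog : log (cexp (θ * I)) = θ * I := by
    refine log_exp ?_ ?_ <;> simp <;> linarith [Real.pi_pos]
  have hpow : ‖cexp (θ * I) ^ (-s)‖ = Real.exp (θ * s.im) := by
    rw [cpow_def_of_ne_zero (exp_ne_zero _), hlog, norm_exp]
    simp
  rw [mul_comm, ← hpow, ← norm_mul, ← integral_cpow_mul_cexp_neg_mul hs (hre ▸ hcos),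
    ← Real.integral_rpow_mul_exp_neg_mul_Ioi hs hcos]
  refine (norm_integral_le_integral_norm _).trans_eq
    (setIntegral_congr_fun measurableSet_Ioi fun t ht => ?_)
  simp only [norm_cpow_mul_cexp_neg_mul s _ ht, hre]

theorem norm_Gamma_le_of_re_pos {s : ℂ} (hs : 0 < s.re) :
    ‖Gamma s‖ ≤ 2 ^ s.re * Real.Gamma s.re * Real.exp (-(Real.pi / 3) * |s.im|) := by
  have hpi := Real.pi_pos
  have hθ (θ : ℝ) (hθ : |θ| = Real.pi / 3) :
      ‖Gamma s‖ * Real.exp (θ * s.im) ≤ 2 ^ s.re * Real.Gamma s.re := by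
    have := norm_Gamma_mul_exp_le hs (θ := θ) (by linarith)
    rwa [← Real.cos_abs, hθ, Real.cos_pi_div_three, one_div_one_div] at this
  rw [neg_mul, Real.exp_neg, ← div_eq_mul_inv, le_div_iff₀ (Real.exp_pos _)]
  rcases abs_cases s.im with ⟨him, -⟩ | ⟨him, -⟩ <;> rw [him]
  · exact hθ _ (abs_of_pos (by positivity))
  · rw [← neg_mul_comm]
    exact hθ _ (by rw [abs_neg, abs_of_pos (by positivity)])

theorem norm_Gamma_le_norm_Gamma_add_nat {s : ℂ} (hs : 1 ≤ |s.im|) (n : ℕ) :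
    ‖Gamma s‖ ≤ ‖Gamma (s + n)‖ := by
  induction n with
  | zero => simp
  | succ n ih =>
    have hnorm : 1 ≤ ‖s + n‖ := hs.trans (by simpa using abs_im_le_norm (s + n))
    rw [Nat.cast_succ, ← add_assoc, Gamma_add_one _ (norm_pos_iff.1 (one_pos.trans_le hnorm)),
      norm_mul]
    exact ih.trans (le_mul_of_one_le_left (norm_nonneg _) hnorm)

theorem exists_norm_Gamma_le (A B : ℝ) : ∃ C : ℝ, ∀ s : ℂ, A ≤ s.re → s.re ≤ B → 1 ≤ |s.im| →
    ‖Gamma s‖ ≤ C * Real.exp (-(Real.pi / 3) * |s.im|) := by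
  obtain ⟨n, hn⟩ := exists_nat_ge (1 - A)
  have hcont : ContinuousOn (fun x : ℝ => (2 : ℝ) ^ x * Real.Gamma x) (Set.Icc 1 (B + n)) :=
    (Real.continuous_const_rpow two_ne_zero).continuousOn.mul
      (Real.differentiableOn_Gamma_Ioi.continuousOn.mono fun x hx => one_pos.trans_le hx.1)
  obtain ⟨C, hC⟩ := isCompact_Icc.exists_bound_of_continuousOn hcont
  refine ⟨C, fun s hA hB him => (norm_Gamma_le_norm_Gamma_add_nat him n).trans ?_⟩
  have hre : 1 ≤ (s + n).re := by rw [add_re, natCast_re]; linarith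
  have hbound := norm_Gamma_le_of_re_pos (one_pos.trans_le hre)
  rw [add_im, natCast_im, add_zero] at hbound
  refine hbound.trans (mul_le_mul_of_nonneg_right ((le_abs_self _).trans (hC _ ⟨hre, ?_⟩))
    (Real.exp_pos _).le)
  rw [add_re, natCast_re]
  linarith

theorem Gamma_const_add_isBigO_stripEnds (B : ℝ) (a : ℂ) :
    (fun s => Gamma (a + s)) =O[stripEnds B] fun s => Real.exp (-(Real.pi / 3) * |s.im|) := by
  obtain ⟨C, hC⟩ := exists_norm_Gamma_le (a.re - B) (a.re + B)
  refine .of_bound (|C| * Real.exp (Real.pi / 3 * |a.im|)) ?_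
  filter_upwards [(tendsto_abs_im_stripEnds B).eventually_ge_atTop (|a.im| + 1),
    eventually_mem_verticalStrip B] with s him hs
  obtain ⟨hs₁, hs₂⟩ := abs_lt.1 (show |s.re| < B from hs)
  have him' : |s.im| - |a.im| ≤ |(a + s).im| := by
    simpa [add_comm] using abs_sub_abs_le_abs_sub s.im (-a.im)
  rw [Real.norm_of_nonneg (Real.exp_pos _).le, mul_assoc, ← Real.exp_add]
  refine (hC (a + s) (by rw [add_re]; linarith) (by rw [add_re]; linarith) (by linarith)).trans ?_
  gcongr
  · exact le_abs_self C
  · linarith [mul_le_mul_of_nonneg_left him' (by positivity : 0 ≤ Real.pi / 3)]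

theorem Gamma_const_sub_isBigO_stripEnds (B : ℝ) (e : ℂ) :
    (fun s => Gamma (e - s)) =O[stripEnds B] fun s => Real.exp (-(Real.pi / 3) * |s.im|) := by
  simpa [Function.comp_def, sub_eq_add_neg] using
    (Gamma_const_add_isBigO_stripEnds B e).comp_tendsto (tendsto_neg_stripEnds B)

theorem exp_neg_mul_abs_im_isBigO_stripEnds (B : ℝ) {δ : ℝ} (hδ : 0 < δ) :
    (fun s : ℂ => Real.exp (-δ * |s.im|)) =O[stripEnds B] fun s => (s.im ^ 2 : ℝ)⁻¹ := by
  refine ((isLittleO_exp_neg_mul_rpow_atTop hδ (-2)).isBigO.comp_tendsto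
    (tendsto_abs_im_stripEnds B)).trans (Asymptotics.isBigO_of_le _ fun s => ?_)
  simp

end GammaDecay

section Translation

variable {X Y : Set ℂ} {γ : ℝ → ℂ} {p : ℂ}

theorem joinedIn_compl_range_add_const {q : ℂ} (h : JoinedIn (Set.range γ)ᶜ p q) (c : ℂ) :
    JoinedIn (Set.range fun t => γ t + c)ᶜ (p + c) (q + c) := by
  refine (h.map (f := (· + c)) (by fun_prop)).mono ?_
  rintro _ ⟨s, hs, rfl⟩ ⟨t, ht⟩
  exact hs ⟨t, add_right_cancel ht⟩

theorem LiesLeft.add_const (h : LiesLeft γ p) (c : ℝ) :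
    LiesLeft (fun t => γ t + c) (p + c) := by
  filter_upwards [(tendsto_atTop_add_const_right atTop c tendsto_id).eventually h] with x hx
  simpa using joinedIn_compl_range_add_const hx c

theorem LiesRight.add_const (h : LiesRight γ p) (c : ℝ) :
    LiesRight (fun t => γ t + c) (p + c) := by
  filter_upwards [(tendsto_atTop_add_const_right atTop (-c) tendsto_id).eventually h] with x hx
  simpa using joinedIn_compl_range_add_const hx c

theorem IsVerticalPath.add_const (h : IsVerticalPath γ) (c : ℝ) :
    IsVerticalPath fun t => γ t + c := by
  obtain ⟨⟨hcont, S, hS, hC1⟩, ⟨B, hB⟩, hbot, htop⟩ := h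
  refine ⟨⟨hcont.add continuous_const, S, hS, fun u v huv hdis =>
    (hC1 u v huv hdis).add contDiffOn_const⟩, ⟨B + |c|, fun t => ?_⟩, by simpa using hbot,
    by simpa using htop⟩
  rw [Complex.add_re, Complex.ofReal_re]
  exact (abs_add_le _ _).trans (add_le_add_left (hB t) _)

theorem Separates.add_const (h : Separates X Y γ) (c : ℝ) :
    Separates {s | s - c ∈ X} {s | s - c ∈ Y} fun t => γ t + c :=
  ⟨h.vertical.add_const c, fun p hp => by simpa using (h.left _ hp).add_const c,
    fun p hp => by simpa using (h.right _ hp).add_const c⟩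

end Translation

section BarnesKernel

variable {a b e d s : ℂ} {γ : ℝ → ℂ}

/-- The integrand of Barnes' integrals. -/
noncomputable def barnesKernel (a b e d s : ℂ) : ℂ :=
  Complex.Gamma (a + s) * Complex.Gamma (b + s) * Complex.Gamma (e - s) * Complex.Gamma (d - s)

/-- The poles of `Γ(a+s)Γ(b+s)`. -/
def leftPoles (a b : ℂ) : Set ℂ := {s | ¬(Admissible (a + s) ∧ Admissible (b + s))}

/-- The poles of `Γ(e-s)Γ(d-s)`. -/
def rightPoles (e d : ℂ) : Set ℂ := {s | ¬(Admissible (e - s) ∧ Admissible (d - s))}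

theorem Admissible.add_one {ξ : ℂ} (h : Admissible ξ) : Admissible (ξ + 1) := fun n hn =>
  h (n + 1) (by push_cast; linear_combination hn)

theorem Admissible.ne_zero {ξ : ℂ} (h : Admissible ξ) : ξ ≠ 0 := by simpa using h 0

theorem leftPoles_comm (a b : ℂ) : leftPoles a b = leftPoles b a := by
  simp only [leftPoles, and_comm]

theorem rightPoles_comm (e d : ℂ) : rightPoles e d = rightPoles d e := by
  simp only [rightPoles, and_comm]

theorem neg_mem_leftPoles : -s ∈ leftPoles e d ↔ s ∈ rightPoles e d := by
  simp only [leftPoles, rightPoles, Set.mem_ofPred_eq, sub_eq_add_neg]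

theorem leftPoles_add_one_subset (a b : ℂ) : leftPoles (a + 1) b ⊆ leftPoles a b :=
  fun s hs h => hs ⟨add_right_comm a s 1 ▸ h.1.add_one, h.2⟩

theorem rightPoles_add_one_subset (e d : ℂ) : rightPoles (e + 1) d ⊆ rightPoles e d := by
  intro s
  simpa only [neg_mem_leftPoles] using @leftPoles_add_one_subset e d (-s)

theorem finite_leftPoles_inter (a b : ℂ) (B : ℝ) : (leftPoles a b ∩ {s | -B ≤ s.re}).Finite := by
  have hfin (c : ℂ) : {s : ℂ | ¬Admissible (c + s) ∧ -B ≤ s.re}.Finite := by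
    obtain ⟨N, hN⟩ := exists_nat_ge (B - c.re)
    refine ((Set.finite_Iic N).image fun n : ℕ => -c - n).subset ?_
    rintro s ⟨hs, hsB⟩
    obtain ⟨n, hn⟩ := not_forall_not.1 hs
    obtain rfl : s = -c - n := by linear_combination hn
    rw [Complex.sub_re, Complex.neg_re, Complex.natCast_re] at hsB
    exact ⟨n, by exact_mod_cast (by linarith : (n : ℝ) ≤ N), rfl⟩
  refine ((hfin a).union (hfin b)).subset ?_
  rintro s ⟨hs, hsB⟩
  exact (not_and_or.1 hs).imp (⟨·, hsB⟩) (⟨·, hsB⟩)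

theorem finite_rightPoles_inter (e d : ℂ) (B : ℝ) : (rightPoles e d ∩ {s | s.re ≤ B}).Finite := by
  refine ((finite_leftPoles_inter e d B).image Neg.neg).subset ?_
  rintro s ⟨hs, hsB⟩
  exact ⟨-s, ⟨neg_mem_leftPoles.2 hs, by simpa using hsB⟩, neg_neg s⟩

theorem finite_poles_inter_verticalStrip (a b e d : ℂ) (B : ℝ) :
    ((leftPoles a b ∪ rightPoles e d) ∩ verticalStrip B).Finite := by
  refine ((finite_leftPoles_inter a b B).union (finite_rightPoles_inter e d B)).subset ?_
  rintro s ⟨hs, hsB⟩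
  obtain ⟨hleft, hright⟩ := abs_lt.1 (show |s.re| < B from hsB)
  exact hs.imp (⟨·, hleft.le⟩) (⟨·, hright.le⟩)

theorem meromorphicAt_barnesKernel (a b e d s : ℂ) : MeromorphicAt (barnesKernel a b e d) s := by
  have hadd (c : ℂ) : MeromorphicAt (fun s => Complex.Gamma (c + s)) s :=
    (Meromorphic.Gamma (c + s)).comp_analyticAt (g := fun s => c + s) (by fun_prop)
  have hsub (c : ℂ) : MeromorphicAt (fun s => Complex.Gamma (c - s)) s :=
    (Meromorphic.Gamma (c - s)).comp_analyticAt (g := fun s => c - s) (by fun_prop)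
  exact (((hadd a).mul (hadd b)).mul (hsub e)).mul (hsub d)

theorem differentiableAt_barnesKernel (hs : s ∉ leftPoles a b ∪ rightPoles e d) :
    DifferentiableAt ℂ (barnesKernel a b e d) s := by
  have hadd (c : ℂ) (hc : Admissible (c + s)) :
      DifferentiableAt ℂ (fun s => Complex.Gamma (c + s)) s :=
    (Complex.differentiableAt_Gamma _ hc).comp s (by fun_prop)
  have hsub (c : ℂ) (hc : Admissible (c - s)) :
      DifferentiableAt ℂ (fun s => Complex.Gamma (c - s)) s :=
    (Complex.differentiableAt_Gamma _ hc).comp s (by fun_prop)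
  obtain ⟨⟨ha, hb⟩, he, hd⟩ := (not_or.1 hs).imp not_not.1 not_not.1
  exact (((hadd a ha).mul (hadd b hb)).mul (hsub e he)).mul (hsub d hd)

theorem barnesKernel_mul_isBigO_stripEnds {B : ℝ} (a b e d : ℂ) {φ : ℂ → ℂ} {κ : ℝ}
    (hφ : φ =O[stripEnds B] fun s => Real.exp (κ * |s.im|)) :
    (fun s => barnesKernel a b e d s * φ s) =O[stripEnds B]
      fun s => Real.exp (-(4 * Real.pi / 3 - κ) * |s.im|) := by
  refine (((((Gamma_const_add_isBigO_stripEnds B a).mul (Gamma_const_add_isBigO_stripEnds B b)).mul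
    (Gamma_const_sub_isBigO_stripEnds B e)).mul (Gamma_const_sub_isBigO_stripEnds B d)).mul
    hφ).congr_right fun s => ?_
  simp only [← Real.exp_add]
  congr 1
  ring

theorem exists_forall_separates_hasContourIntegral_barnesKernel_mul (a b e d : ℂ) {φ : ℂ → ℂ}
    {κ : ℝ} (hφ : Differentiable ℂ φ) (hκ : κ < 4 * Real.pi / 3)
    (hdec : ∀ B, φ =O[stripEnds B] fun s => Real.exp (κ * |s.im|)) :
    ∃ J, ∀ γ, Separates (leftPoles a b) (rightPoles e d) γ →
      HasContourIntegral γ (fun s => barnesKernel a b e d s * φ s) J :=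
  exists_forall_separates_hasContourIntegral
    (fun s => (meromorphicAt_barnesKernel a b e d s).mul (hφ.analyticAt s).meromorphicAt)
    (fun s hs => (differentiableAt_barnesKernel hs).mul (hφ s))
    (finite_poles_inter_verticalStrip a b e d) fun B =>
      (barnesKernel_mul_isBigO_stripEnds a b e d (hdec B)).trans
        (exp_neg_mul_abs_im_isBigO_stripEnds B (sub_pos.2 hκ))

theorem one_isBigO_stripEnds (B : ℝ) :
    (fun _ => 1 : ℂ → ℂ) =O[stripEnds B] fun s => Real.exp (0 * |s.im|) :=
  .of_bound 1 (by simp)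

theorem exists_forall_separates_hasContourIntegral_barnesKernel (a b e d : ℂ) :
    ∃ J, ∀ γ, Separates (leftPoles a b) (rightPoles e d) γ →
      HasContourIntegral γ (barnesKernel a b e d) J := by
  simpa only [mul_one] using exists_forall_separates_hasContourIntegral_barnesKernel_mul a b e d
    (differentiable_const 1) (by positivity) one_isBigO_stripEnds

end BarnesKernel

section Contiguity

variable {a b e d s J J' : ℂ} {γ : ℝ → ℂ}

theorem barnesKernel_swap_left (a b e d : ℂ) : barnesKernel a b e d = barnesKernel b a e d := by
  funext s
  rw [barnesKernel, barnesKernel, mul_comm (Complex.Gamma (a + s))]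

theorem barnesKernel_swap_right (a b e d : ℂ) : barnesKernel a b e d = barnesKernel a b d e := by
  funext s
  rw [barnesKernel, barnesKernel, mul_right_comm]

theorem barnesKernel_add_one_left (h : a + s ≠ 0) :
    barnesKernel (a + 1) b e d s = (a + s) * barnesKernel a b e d s := by
  simp only [barnesKernel, add_right_comm a 1 s, Complex.Gamma_add_one _ h, mul_assoc]

theorem barnesKernel_add_one_right (h : e - s ≠ 0) :
    barnesKernel a b (e + 1) d s = (e - s) * barnesKernel a b e d s := by
  rw [barnesKernel, barnesKernel, add_sub_right_comm, Complex.Gamma_add_one _ h]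
  ring

theorem barnesKernel_add_const (a b e d c s : ℂ) :
    barnesKernel a b (e + c) (d + c) (s + c) = barnesKernel (a + c) (b + c) e d s := by
  simp only [barnesKernel, add_sub_add_right_eq_sub, add_assoc, add_comm c s]

theorem Separates.poles_ne_zero (h : Separates (leftPoles a b) (rightPoles e d) γ) (t : ℝ) :
    (a + γ t ≠ 0 ∧ b + γ t ≠ 0) ∧ e - γ t ≠ 0 ∧ d - γ t ≠ 0 := by
  obtain ⟨⟨ha, hb⟩, he, hd⟩ := (not_or.1 (h.notMem_union t)).imp not_not.1 not_not.1
  exact ⟨⟨ha.ne_zero, hb.ne_zero⟩, he.ne_zero, hd.ne_zero⟩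

theorem rightPoles_add_one_add_one_subset (e d : ℂ) :
    rightPoles (e + 1) (d + 1) ⊆ rightPoles e d :=
  (rightPoles_add_one_subset e _).trans <| by
    rw [rightPoles_comm, rightPoles_comm e]
    exact rightPoles_add_one_subset d e

theorem Separates.add_one_poles (h : Separates (leftPoles a b) (rightPoles e d) γ) :
    Separates (leftPoles a b) (rightPoles (e + 1) (d + 1)) fun t => γ t + 1 := by
  refine (Complex.ofReal_one ▸ h.add_const 1).mono (fun s hs hs' => hs ?_) fun s hs => ?_
  · simpa only [add_assoc, sub_add_cancel] using hs'.imp Admissible.add_one Admissible.add_one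
  · simpa only [rightPoles, Set.mem_ofPred_eq, sub_sub_eq_add_sub] using hs

/-- The contour and its translate by `1` give the same integral of the kernel with `e`, `d` raised
by `1`. -/
theorem Separates.hasContourIntegral_barnesKernel_mul_quadratic
    (h : Separates (leftPoles a b) (rightPoles e d) γ) : HasContourIntegral γ
      (fun s => barnesKernel a b e d s * ((a + s) * (b + s) - (e - s) * (d - s))) 0 := by
  obtain ⟨J, hJ⟩ := exists_forall_separates_hasContourIntegral_barnesKernel a b (e + 1) (d + 1)
  have hshift := (hJ _ h.add_one_poles).comp_add_const.sub
    (hJ γ (h.mono subset_rfl (rightPoles_add_one_add_one_subset e d)))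
  rw [sub_self] at hshift
  refine hshift.congr fun t => ?_
  obtain ⟨⟨ha, hb⟩, he, hd⟩ := h.poles_ne_zero t
  rw [barnesKernel_add_const, barnesKernel_add_one_left ha, barnesKernel_swap_left,
    barnesKernel_add_one_left hb, barnesKernel_add_one_right he, barnesKernel_swap_right a,
    barnesKernel_add_one_right hd, barnesKernel_swap_left b, barnesKernel_swap_right a b d]
  ring

theorem Separates.contiguous_left (h : Separates (leftPoles a b) (rightPoles e d) γ)
    (hJ : HasContourIntegral γ (barnesKernel a b e d) J)
    (hJ' : HasContourIntegral γ (barnesKernel (a + 1) b e d) J') :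
    (a + e) * (a + d) * J = (a + b + e + d) * J' := by
  have hdiff : HasContourIntegral γ (fun s => (a + b + e + d) * barnesKernel (a + 1) b e d s -
      (a + e) * (a + d) * barnesKernel a b e d s) 0 := by
    refine h.hasContourIntegral_barnesKernel_mul_quadratic.congr fun t => ?_
    rw [barnesKernel_add_one_left (h.poles_ne_zero t).1.1]
    ring
  linear_combination -(((hJ'.const_mul _).sub (hJ.const_mul _)).unique hdiff)

theorem Separates.contiguous_right (h : Separates (leftPoles a b) (rightPoles e d) γ)
    (hJ : HasContourIntegral γ (barnesKernel a b e d) J)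
    (hJ' : HasContourIntegral γ (barnesKernel a b (e + 1) d) J') :
    (a + e) * (b + e) * J = (a + b + e + d) * J' := by
  have hdiff : HasContourIntegral γ (fun s => (a + e) * (b + e) * barnesKernel a b e d s -
      (a + b + e + d) * barnesKernel a b (e + 1) d s) 0 := by
    refine h.hasContourIntegral_barnesKernel_mul_quadratic.congr fun t => ?_
    rw [barnesKernel_add_one_right (h.poles_ne_zero t).2.1]
    ring
  linear_combination ((hJ.const_mul _).sub (hJ'.const_mul _)).unique hdiff

end Contiguity

section TamePath

/-- A `C¹` path in a vertical strip with bounded speed and height of at least linear growth: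
integrands with exponential decay in the strip are absolutely integrable along it. -/
structure IsTamePath (γ : ℝ → ℂ) : Prop where
  contDiff : ContDiff ℝ 1 γ
  exists_norm_deriv_le : ∃ M, ∀ t, ‖deriv γ t‖ ≤ M
  exists_abs_re_le : ∃ B, ∀ t, |(γ t).re| ≤ B
  exists_abs_le_abs_im_add : ∃ R, ∀ t, |t| ≤ |(γ t).im| + R

/-- The image of the graph `{(g y, y)}` under the shear `(x, y) ↦ (x, y - ε x)`, which serves to
give distinct heights to the points that are to be separated. -/
def shearedGraph (g : ℝ → ℝ) (ε t : ℝ) : ℂ := ⟨g t, t - ε * g t⟩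

namespace shearedGraph

variable {g : ℝ → ℝ} {ε B M : ℝ}

theorem eq_ofReal_add (g : ℝ → ℝ) (ε : ℝ) :
    shearedGraph g ε = fun t => (g t : ℂ) + ((t - ε * g t : ℝ) : ℂ) * Complex.I := by
  funext t
  apply Complex.ext <;> simp [shearedGraph]

theorem contDiff (hg : ContDiff ℝ 1 g) : ContDiff ℝ 1 (shearedGraph g ε) := by
  rw [eq_ofReal_add]
  exact (Complex.ofRealCLM.contDiff.comp hg).add
    ((Complex.ofRealCLM.contDiff.comp (contDiff_id.sub (contDiff_const.mul hg))).mul contDiff_const)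

theorem injective : Function.Injective (shearedGraph g ε) := by
  intro t t' h
  have hre : g t = g t' := congrArg Complex.re h
  have him : t - ε * g t = t' - ε * g t' := congrArg Complex.im h
  rw [hre] at him
  linarith

theorem norm_deriv_le (hg : ContDiff ℝ 1 g) (hM : ∀ t, |deriv g t| ≤ M) (t : ℝ) :
    ‖deriv (shearedGraph g ε) t‖ ≤ M + (1 + |ε| * M) := by
  have hg' : HasDerivAt g (deriv g t) t := (hg.differentiable one_ne_zero t).hasDerivAt
  have hderiv : HasDerivAt (shearedGraph g ε)
      (((deriv g t : ℝ) : ℂ) + ((1 - ε * deriv g t : ℝ) : ℂ) * Complex.I) t := by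
    rw [eq_ofReal_add]
    exact hg'.ofReal_comp.add
      (((hasDerivAt_id t).sub (hg'.const_mul ε)).ofReal_comp.mul_const Complex.I)
  have hshear : |1 - ε * deriv g t| ≤ 1 + |ε| * M := by
    refine (abs_sub _ _).trans ?_
    rw [abs_one, abs_mul]
    gcongr
    exact hM t
  rw [hderiv.deriv]
  refine (norm_add_le _ _).trans (add_le_add ?_ ?_)
  · simpa only [Complex.norm_real, Real.norm_eq_abs] using hM t
  · simpa only [norm_mul, Complex.norm_I, mul_one, Complex.norm_real, Real.norm_eq_abs] using hshear

theorem abs_im_sub_le (hB : ∀ t, |g t| ≤ B) (t : ℝ) :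
    |(shearedGraph g ε t).im - t| ≤ |ε| * B := by
  rw [shearedGraph, sub_sub_cancel_left, abs_neg, abs_mul]
  exact mul_le_mul_of_nonneg_left (hB t) (abs_nonneg _)

theorem isTamePath (hg : ContDiff ℝ 1 g) (hB : ∀ t, |g t| ≤ B) (hM : ∀ t, |deriv g t| ≤ M) :
    IsTamePath (shearedGraph g ε) :=
  ⟨contDiff hg, ⟨_, norm_deriv_le hg hM⟩, ⟨B, hB⟩, |ε| * B, fun t => by
    have := abs_sub_abs_le_abs_sub t (shearedGraph g ε t).im
    rw [abs_sub_comm] at this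
    linarith [abs_im_sub_le (ε := ε) hB t]⟩

theorem isVerticalPath (hg : ContDiff ℝ 1 g) (hB : ∀ t, |g t| ≤ B) :
    IsVerticalPath (shearedGraph g ε) := by
  refine ⟨⟨(contDiff hg).continuous, ∅, by simp, fun u v _ _ => (contDiff hg).contDiffOn⟩,
    ⟨B, hB⟩,
    tendsto_atBot_mono (fun t => ?_) (tendsto_atBot_add_const_right _ (|ε| * B) tendsto_id),
    tendsto_atTop_mono (fun t => ?_) (tendsto_atTop_add_const_right _ (-(|ε| * B)) tendsto_id)⟩
  · linarith [(abs_le.1 (abs_im_sub_le (ε := ε) hB t)).2, id_eq t]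
  · linarith [(abs_le.1 (abs_im_sub_le (ε := ε) hB t)).1, id_eq t]

theorem joinedIn_compl_range (hB : ∀ t, |g t| ≤ B) {p : ℂ} {x : ℝ} (hx : B < |x|)
    (hpx : ∀ u ∈ Set.uIcc p.re x, u ≠ g (p.im + ε * p.re)) :
    JoinedIn (Set.range (shearedGraph g ε))ᶜ p x := by
  set q : ℂ := ⟨x, p.im + ε * p.re - ε * x⟩ with hq
  have hpq : JoinedIn (Set.range (shearedGraph g ε))ᶜ p q := by
    refine JoinedIn.of_segment_subset ?_
    rintro _ ⟨α, β, hα, hβ, hαβ, rfl⟩ ⟨t, ht⟩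
    have hre : g t = α * p.re + β * x := by simpa [shearedGraph, hq] using congrArg Complex.re ht
    have him : t - ε * g t = α * p.im + β * (p.im + ε * p.re - ε * x) := by
      simpa [shearedGraph, hq] using congrArg Complex.im ht
    have ht' : t = p.im + ε * p.re := by
      linear_combination him + ε * hre + (p.im + ε * p.re) * hαβ
    have hmem : α * p.re + β * x ∈ Set.uIcc p.re x :=
      segment_eq_uIcc p.re x ▸ (⟨α, β, hα, hβ, hαβ, rfl⟩ : _ ∈ segment ℝ p.re x)
    exact hpx _ hmem (by rw [← hre, ht'])
  refine hpq.trans (JoinedIn.of_segment_subset ?_)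
  rintro _ ⟨α, β, -, -, hαβ, rfl⟩ ⟨t, ht⟩
  have hre : g t = α * x + β * x := by simpa [shearedGraph, hq] using congrArg Complex.re ht
  rw [← add_mul, hαβ, one_mul] at hre
  exact (hre ▸ hB t).not_gt hx

theorem liesLeft (hB : ∀ t, |g t| ≤ B) {p : ℂ} (hp : p.re < g (p.im + ε * p.re)) :
    LiesLeft (shearedGraph g ε) p := by
  filter_upwards [eventually_gt_atTop B, eventually_ge_atTop (-p.re)] with x hx hxp
  rw [← Complex.ofReal_neg]
  refine joinedIn_compl_range hB ((abs_neg x).symm ▸ hx.trans_le (le_abs_self x)) fun u hu => ?_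
  rw [Set.uIcc_of_ge (by linarith)] at hu
  exact (hu.2.trans_lt hp).ne

theorem liesRight (hB : ∀ t, |g t| ≤ B) {p : ℂ} (hp : g (p.im + ε * p.re) < p.re) :
    LiesRight (shearedGraph g ε) p := by
  filter_upwards [eventually_gt_atTop B, eventually_ge_atTop p.re] with x hx hxp
  refine joinedIn_compl_range hB (hx.trans_le (le_abs_self x)) fun u hu => ?_
  rw [Set.uIcc_of_le hxp] at hu
  exact (hp.trans_le hu.1).ne'

end shearedGraph

variable {X Y : Set ℂ}

theorem exists_disjoint_image_shear (hX : X.Finite) (hY : Y.Finite) (hXY : Disjoint X Y) :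
    ∃ ε : ℝ, Disjoint ((fun p : ℂ => p.im + ε * p.re) '' X)
      ((fun p : ℂ => p.im + ε * p.re) '' Y) := by
  obtain ⟨ε, hε⟩ :=
    ((hX.prod hY).image fun r : ℂ × ℂ => (r.2.im - r.1.im) / (r.1.re - r.2.re)).exists_notMem
  refine ⟨ε, Set.disjoint_left.2 ?_⟩
  rintro _ ⟨p, hp, rfl⟩ ⟨q, hq, hpq⟩
  rcases eq_or_ne p.re q.re with hre | hre
  · have hqp : q = p := Complex.ext hre.symm (by simpa [hre] using hpq)
    exact Set.disjoint_left.1 hXY hp (hqp ▸ hq)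
  · refine hε ⟨(p, q), ⟨hp, hq⟩, (div_eq_iff (sub_ne_zero.2 hre)).2 ?_⟩
    linear_combination hpq

open scoped Manifold in
theorem exists_contDiff_eqOn_of_finite {S T : Set ℝ} (hS : S.Finite) (hT : T.Finite)
    (hST : Disjoint S T) {B : ℝ} (hB : 0 ≤ B) :
    ∃ g : ℝ → ℝ, ContDiff ℝ 1 g ∧ (∀ t, |g t| ≤ B) ∧ (∀ t ∈ S, g t = B) ∧ (∀ t ∈ T, g t = -B) ∧
      ∃ M, ∀ t, |deriv g t| ≤ M := by
  obtain ⟨R, hR⟩ := hT.isBounded.subset_ball 0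
  obtain ⟨f, hf₀, hf₁, hf⟩ := exists_contMDiffMap_zero_one_of_isClosed (n := 1) 𝓘(ℝ, ℝ)
    (s := S ∪ (Metric.ball 0 R)ᶜ) (hS.isClosed.union Metric.isOpen_ball.isClosed_compl)
    hT.isClosed (Set.disjoint_union_left.2 ⟨hST, Set.disjoint_left.2 fun x hx hx' => hx (hR hx')⟩)
  have hfC1 : ContDiff ℝ 1 f := f.contMDiff.contDiff
  have hfsupp : HasCompactSupport f :=
    .intro (isCompact_closedBall 0 R) fun t ht =>
      hf₀ (.inr fun h => ht (Metric.ball_subset_closedBall h))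
  obtain ⟨M, hM⟩ := hfsupp.deriv.exists_bound_of_continuous (hfC1.continuous_deriv le_rfl)
  refine ⟨fun t => B - 2 * B * f t, contDiff_const.sub (contDiff_const.mul hfC1),
    fun t => abs_le.2 ⟨?_, ?_⟩, fun t ht => ?_, fun t ht => ?_, 2 * B * M, fun t => ?_⟩
  · nlinarith [(hf t).2]
  · nlinarith [(hf t).1]
  · simp [hf₀ (.inl ht)]
  · have : f t = 1 := hf₁ ht
    simp only [this]
    ring
  · rw [deriv_const_sub, deriv_const_mul _ (hfC1.differentiable one_ne_zero t), abs_neg, abs_mul,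
      abs_of_nonneg (by positivity)]
    exact mul_le_mul_of_nonneg_left (hM t) (by positivity)

theorem exists_isTamePath_separates {B : ℝ} (hB : 0 ≤ B) (hXY : Disjoint X Y)
    (hXB : ∀ p ∈ X, p.re < B) (hYB : ∀ p ∈ Y, -B < p.re) (hX : (X ∩ {s | -B ≤ s.re}).Finite)
    (hY : (Y ∩ {s | s.re ≤ B}).Finite) :
    ∃ γ, Function.Injective γ ∧ IsTamePath γ ∧ Separates X Y γ := by
  obtain ⟨ε, hε⟩ := exists_disjoint_image_shear hX hY
    (hXY.mono Set.inter_subset_left Set.inter_subset_left)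
  obtain ⟨g, hg, hgB, hgX, hgY, M, hM⟩ :=
    exists_contDiff_eqOn_of_finite (hX.image _) (hY.image _) hε hB
  refine ⟨shearedGraph g ε, shearedGraph.injective, shearedGraph.isTamePath hg hgB hM,
    shearedGraph.isVerticalPath hg hgB, fun p hp => shearedGraph.liesLeft hgB ?_,
    fun p hp => shearedGraph.liesRight hgB ?_⟩
  · rcases le_or_gt (-B) p.re with h | h
    · exact (hXB p hp).trans_eq (hgX _ ⟨p, ⟨hp, h⟩, rfl⟩).symm
    · exact h.trans_le (abs_le.1 (hgB _)).1
  · rcases le_or_gt p.re B with h | h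
    · exact (hgY _ ⟨p, ⟨hp, h⟩, rfl⟩).trans_lt (hYB p hp)
    · exact (abs_le.1 (hgB _)).2.trans_lt h

theorem ofReal_mul_I_eq_shearedGraph :
    (fun t : ℝ => (t : ℂ) * Complex.I) = shearedGraph (fun _ => 0) 0 := by
  simp [shearedGraph.eq_ofReal_add]

theorem isTamePath_ofReal_mul_I : IsTamePath fun t : ℝ => (t : ℂ) * Complex.I :=
  ofReal_mul_I_eq_shearedGraph ▸
    shearedGraph.isTamePath contDiff_const (B := 0) (M := 0) (by simp) (by simp)

theorem separates_ofReal_mul_I (hX : ∀ p ∈ X, p.re < 0) (hY : ∀ p ∈ Y, 0 < p.re) :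
    Separates X Y fun t : ℝ => (t : ℂ) * Complex.I :=
  have hzero : ∀ _ : ℝ, |(0 : ℝ)| ≤ 0 := by simp
  ofReal_mul_I_eq_shearedGraph ▸ ⟨shearedGraph.isVerticalPath contDiff_const hzero,
    fun p hp => shearedGraph.liesLeft hzero (hX p hp),
    fun p hp => shearedGraph.liesRight hzero (hY p hp)⟩

end TamePath

section PoleSeparation

variable {a b e d s : ℂ}

theorem re_le_of_mem_leftPoles (hs : s ∈ leftPoles a b) : s.re ≤ max (-a.re) (-b.re) := by
  have hre (c : ℂ) (hc : ¬Admissible (c + s)) : s.re ≤ -c.re := by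
    obtain ⟨n, hn⟩ := not_forall_not.1 hc
    have := congrArg Complex.re hn
    simp only [Complex.add_re, Complex.neg_re, Complex.natCast_re] at this
    linarith [n.cast_nonneg (α := ℝ)]
  exact le_max_iff.2 ((not_and_or.1 hs).imp (hre a) (hre b))

theorem le_re_of_mem_rightPoles (hs : s ∈ rightPoles e d) : -max (-e.re) (-d.re) ≤ s.re := by
  simpa [neg_le] using re_le_of_mem_leftPoles (neg_mem_leftPoles.2 hs)

theorem Admissible.or_of_add (h : Admissible (a + e)) (s : ℂ) :
    Admissible (a + s) ∨ Admissible (e - s) := by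
  by_contra! hne
  obtain ⟨n, hn⟩ := not_forall_not.1 hne.1
  obtain ⟨m, hm⟩ := not_forall_not.1 hne.2
  exact h (n + m) (by push_cast; linear_combination hn + hm)

theorem disjoint_leftPoles_rightPoles (hae : Admissible (a + e)) (had : Admissible (a + d))
    (hbe : Admissible (b + e)) (hbd : Admissible (b + d)) :
    Disjoint (leftPoles a b) (rightPoles e d) := by
  refine Set.disjoint_left.2 fun s hl hr => ?_
  have hae := hae.or_of_add s
  have had := had.or_of_add s
  have hbe := hbe.or_of_add s
  have hbd := hbd.or_of_add s
  simp only [leftPoles, rightPoles, Set.mem_ofPred_eq] at hl hr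
  tauto

theorem exists_isTamePath_separates_poles (hae : Admissible (a + e)) (had : Admissible (a + d))
    (hbe : Admissible (b + e)) (hbd : Admissible (b + d)) :
    ∃ γ, Function.Injective γ ∧ IsTamePath γ ∧ Separates (leftPoles a b) (rightPoles e d) γ := by
  set L := max (-a.re) (-b.re)
  set R := max (-e.re) (-d.re)
  refine exists_isTamePath_separates (B := max 0 (max L R) + 1) (by positivity)
    (disjoint_leftPoles_rightPoles hae had hbe hbd)
    (fun p hp => (re_le_of_mem_leftPoles hp).trans_lt ?_)
    (fun p hp => (le_re_of_mem_rightPoles hp).trans_lt' (neg_lt_neg ?_))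
    (finite_leftPoles_inter a b _) (finite_rightPoles_inter e d _)
  · exact lt_add_of_le_of_pos ((le_max_left L R).trans (le_max_right _ _)) one_pos
  · exact lt_add_of_le_of_pos ((le_max_right L R).trans (le_max_right _ _)) one_pos

theorem separates_poles_ofReal_mul_I (ha : 0 < a.re) (hb : 0 < b.re) (he : 0 < e.re)
    (hd : 0 < d.re) :
    Separates (leftPoles a b) (rightPoles e d) fun t : ℝ => (t : ℂ) * Complex.I :=
  separates_ofReal_mul_I
    (fun _ hp => (re_le_of_mem_leftPoles hp).trans_lt (by simp [ha, hb]))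
    (fun _ hp => (le_re_of_mem_rightPoles hp).trans_lt' (by simp [he, hd]))

end PoleSeparation

section TameIntegrability

theorem exists_norm_le_mul_of_isBigO_cocompact {X E : Type*} [TopologicalSpace X]
    [SeminormedAddCommGroup E] {f : X → E} {g : X → ℝ} (hf : Continuous f) (hg : Continuous g)
    (hpos : ∀ x, 0 < g x) (h : f =O[cocompact X] g) : ∃ C, ∀ x, ‖f x‖ ≤ C * g x := by
  obtain ⟨C, hC⟩ := h.bound
  obtain ⟨K, hK, hKC⟩ := mem_cocompact.1 hC
  obtain ⟨D, hD⟩ := hK.exists_bound_of_continuousOn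
    (f := fun x => ‖f x‖ / g x) (hf.norm.div hg fun x => (hpos x).ne').continuousOn
  refine ⟨max C D, fun x => ?_⟩
  by_cases hx : x ∈ K
  · rw [← div_le_iff₀ (hpos x)]
    exact (le_abs_self _).trans ((hD x hx).trans (le_max_right C D))
  · have hCx : ‖f x‖ ≤ C * ‖g x‖ := hKC hx
    rw [Real.norm_of_nonneg (hpos x).le] at hCx
    exact hCx.trans (mul_le_mul_of_nonneg_right (le_max_left C D) (hpos x).le)

theorem integrable_exp_neg_mul_abs {δ : ℝ} (hδ : 0 < δ) :
    Integrable fun y : ℝ => Real.exp (-δ * |y|) := by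
  rw [← integrableOn_univ, ← Set.Iic_union_Ioi (a := (0 : ℝ))]
  refine IntegrableOn.union ?_ ?_
  · refine (integrableOn_exp_mul_Iic hδ 0).congr_fun (fun y hy => ?_) measurableSet_Iic
    rw [abs_of_nonpos hy, neg_mul_neg]
  · refine (integrableOn_exp_mul_Ioi (neg_neg_of_pos hδ) 0).congr_fun (fun y hy => ?_)
      measurableSet_Ioi
    rw [abs_of_pos hy]

namespace IsTamePath

variable {E : Type*} [NormedAddCommGroup E] {γ : ℝ → ℂ} {f : ℂ → E} {δ : ℝ}

theorem exists_tendsto_stripEnds (hγ : IsTamePath γ) :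
    ∃ B, Tendsto γ (cocompact ℝ) (stripEnds B) := by
  obtain ⟨B, hB⟩ := hγ.exists_abs_re_le
  obtain ⟨R, hR⟩ := hγ.exists_abs_le_abs_im_add
  refine ⟨B + 1, tendsto_stripEnds_iff.2 ⟨?_, .of_forall fun t => (hB t).trans_lt (lt_add_one B)⟩⟩
  exact tendsto_atTop_mono (fun t => sub_le_iff_le_add.2 (hR t))
    (tendsto_atTop_add_const_right _ (-R) (tendsto_norm_cocompact_atTop (E := ℝ)))

theorem exists_norm_comp_le (hγ : IsTamePath γ) (hδ : 0 ≤ δ) (hcont : Continuous fun t => f (γ t))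
    (hf : ∀ B, f =O[stripEnds B] fun s => Real.exp (-δ * |s.im|)) :
    ∃ C, ∀ t, ‖f (γ t)‖ ≤ C * Real.exp (-δ * |t|) := by
  obtain ⟨B, hB⟩ := hγ.exists_tendsto_stripEnds
  obtain ⟨R, hR⟩ := hγ.exists_abs_le_abs_im_add
  refine exists_norm_le_mul_of_isBigO_cocompact hcont (by fun_prop) (fun t => Real.exp_pos _)
    (((hf B).comp_tendsto hB).trans (.of_bound (Real.exp (δ * R)) (.of_forall fun t => ?_)))
  rw [Function.comp_apply, Real.norm_of_nonneg (Real.exp_pos _).le,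
    Real.norm_of_nonneg (Real.exp_pos _).le, ← Real.exp_add]
  gcongr
  linarith [mul_le_mul_of_nonneg_left (hR t) hδ]

theorem integrable_comp (hγ : IsTamePath γ) (hδ : 0 < δ) (hcont : Continuous fun t => f (γ t))
    (hf : ∀ B, f =O[stripEnds B] fun s => Real.exp (-δ * |s.im|)) :
    Integrable fun t => f (γ t) := by
  obtain ⟨C, hC⟩ := hγ.exists_norm_comp_le hδ.le hcont hf
  exact ((integrable_exp_neg_mul_abs hδ).const_mul C).mono' hcont.aestronglyMeasurable
    (.of_forall hC)

end IsTamePath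

theorem Separates.continuous_barnesKernel {a b e d : ℂ} {γ : ℝ → ℂ}
    (h : Separates (leftPoles a b) (rightPoles e d) γ) :
    Continuous fun t => barnesKernel a b e d (γ t) :=
  continuous_iff_continuousAt.2 fun t =>
    (differentiableAt_barnesKernel (h.notMem_union t)).continuousAt.comp
      h.vertical.piecewiseC1.1.continuousAt

theorem continuous_Gamma_add_mul_I {a : ℂ} (ha : 0 < a.re) :
    Continuous fun y : ℝ => Complex.Gamma (a + y * Complex.I) := by
  refine continuous_iff_continuousAt.2 fun y => ContinuousAt.comp (g := Complex.Gamma)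
    (Complex.continuousAt_Gamma _ fun m h => ?_) (by fun_prop)
  have hre : a.re = -m := by simpa using congrArg Complex.re h
  linarith [m.cast_nonneg (α := ℝ)]

theorem continuous_Gamma_sub_mul_I {d : ℂ} (hd : 0 < d.re) :
    Continuous fun y : ℝ => Complex.Gamma (d - y * Complex.I) := by
  simpa [Function.comp_def, sub_eq_add_neg] using
    (continuous_Gamma_add_mul_I hd).comp continuous_neg

theorem integrable_Gamma_mul_Gamma_mul_I {a d : ℂ} (ha : 0 < a.re) (hd : 0 < d.re) :
    Integrable fun y : ℝ =>
      Complex.Gamma (a + y * Complex.I) * Complex.Gamma (d - y * Complex.I) := by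
  refine isTamePath_ofReal_mul_I.integrable_comp (δ := 2 * Real.pi / 3)
    (f := fun s => Complex.Gamma (a + s) * Complex.Gamma (d - s)) (by positivity)
    ((continuous_Gamma_add_mul_I ha).mul (continuous_Gamma_sub_mul_I hd)) fun B => ?_
  refine ((Gamma_const_add_isBigO_stripEnds B a).mul
    (Gamma_const_sub_isBigO_stripEnds B d)).congr_right fun s => ?_
  rw [← Real.exp_add]
  ring_nf

theorem integrable_barnesKernel_mul_I {a b e d : ℂ} (ha : 0 < a.re) (hb : 0 < b.re)
    (he : 0 < e.re) (hd : 0 < d.re) :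
    Integrable fun y : ℝ => barnesKernel a b e d (y * Complex.I) := by
  refine isTamePath_ofReal_mul_I.integrable_comp (δ := 4 * Real.pi / 3 - 0) (by simp [Real.pi_pos])
    (separates_poles_ofReal_mul_I ha hb he hd).continuous_barnesKernel fun B => ?_
  simpa only [mul_one] using barnesKernel_mul_isBigO_stripEnds a b e d (one_isBigO_stripEnds B)

end TameIntegrability

section BetaMellin

open Complex

theorem image_div_one_sub_Ioo : (fun u : ℝ => u / (1 - u)) '' Set.Ioo 0 1 = Set.Ioi 0 := by
  ext t
  refine ⟨?_, fun ht => ?_⟩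
  · rintro ⟨u, hu, rfl⟩
    exact div_pos hu.1 (sub_pos.2 hu.2)
  · have ht : 0 < t := ht
    refine ⟨t / (1 + t), ⟨by positivity, by rw [div_lt_one (by positivity)]; linarith⟩, ?_⟩
    dsimp only
    rw [one_sub_div (by positivity), add_sub_cancel_right]
    field_simp

theorem injOn_div_one_sub_Ioo : Set.InjOn (fun u : ℝ => u / (1 - u)) (Set.Ioo 0 1) := by
  intro u hu v hv h
  have huv := (div_eq_div_iff (sub_pos.2 hu.2).ne' (sub_pos.2 hv.2).ne').1 h
  linarith

theorem hasDerivWithinAt_div_one_sub {u : ℝ} (hu : u ∈ Set.Ioo (0 : ℝ) 1) :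
    HasDerivWithinAt (fun u : ℝ => u / (1 - u)) (1 / (1 - u) ^ 2) (Set.Ioo 0 1) u := by
  have h := (hasDerivAt_id u).div ((hasDerivAt_id u).const_sub 1) (sub_pos.2 hu.2).ne'
  exact (h.congr_deriv (by simp)).hasDerivWithinAt

theorem abs_deriv_smul_mellin_integrand (r s : ℂ) {u : ℝ} (hu : u ∈ Set.Ioo (0 : ℝ) 1) :
    |1 / (1 - u) ^ 2| • ((u / (1 - u) : ℝ) : ℂ) ^ (s - 1) •
      (1 + ((u / (1 - u) : ℝ) : ℂ)) ^ (-r) = (u : ℂ) ^ (s - 1) * (1 - (u : ℂ)) ^ (r - s - 1) := by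
  have hu₀ := hu.1
  have hu₁ : 0 < 1 - u := sub_pos.2 hu.2
  have hcast : (1 - u : ℂ) = ((1 - u : ℝ) : ℂ) := by push_cast; rfl
  have hne : (1 - u : ℂ) ≠ 0 := by rw [hcast]; exact_mod_cast hu₁.ne'
  have hadd : (1 + ((u / (1 - u) : ℝ) : ℂ)) = (((1 - u)⁻¹ : ℝ) : ℂ) := by
    push_cast
    field_simp
    ring
  have hinv (w : ℂ) : (((1 - u)⁻¹ : ℝ) : ℂ) ^ w = (1 - u : ℂ) ^ (-w) := by
    rw [hcast, ofReal_inv, cpow_neg,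
      inv_cpow _ _ (arg_ofReal_of_nonneg hu₁.le ▸ Real.pi_ne_zero.symm)]
  rw [hadd, div_eq_mul_inv u, ofReal_mul, mul_cpow_ofReal_nonneg hu₀.le (inv_pos.2 hu₁).le, hinv,
    hinv, abs_of_pos (by positivity), real_smul, smul_eq_mul,
    show r - s - 1 = -(s - 1) + (r + -2) by ring, cpow_add _ _ hne, cpow_add _ _ hne, neg_neg,
    cpow_neg _ 2, cpow_ofNat]
  push_cast
  ring

theorem mellinConvergent_one_add_cpow_neg {r s : ℂ} (hs : 0 < s.re) (hsr : s.re < r.re) :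
    MellinConvergent (fun t : ℝ => (1 + t : ℂ) ^ (-r)) s := by
  rw [MellinConvergent, ← image_div_one_sub_Ioo, integrableOn_image_iff_integrableOn_abs_deriv_smul
    measurableSet_Ioo (fun u hu => hasDerivWithinAt_div_one_sub hu) injOn_div_one_sub_Ioo]
  have h := betaIntegral_convergent hs (v := r - s) (by simpa using hsr)
  rw [intervalIntegrable_iff_integrableOn_Ioo_of_le zero_le_one] at h
  exact h.congr_fun (fun u hu => (abs_deriv_smul_mellin_integrand r s hu).symm) measurableSet_Ioo

theorem mellin_one_add_cpow_neg {r s : ℂ} (hs : 0 < s.re) (hsr : s.re < r.re) :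
    mellin (fun t : ℝ => (1 + t : ℂ) ^ (-r)) s = Gamma s * Gamma (r - s) / Gamma r := by
  have hbeta := betaIntegral_eq_Gamma_mul_div s (r - s) hs (by simpa using hsr)
  rw [add_sub_cancel] at hbeta
  rw [← hbeta, betaIntegral, intervalIntegral.integral_of_le zero_le_one,
    integral_Ioc_eq_integral_Ioo, mellin, ← image_div_one_sub_Ioo,
    integral_image_eq_integral_abs_deriv_smul measurableSet_Ioo
      (fun u hu => hasDerivWithinAt_div_one_sub hu) injOn_div_one_sub_Ioo]
  exact setIntegral_congr_fun measurableSet_Ioo fun u hu => abs_deriv_smul_mellin_integrand r s hu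

theorem Gamma_add_mul_mellin_one_add_cpow_neg {x y : ℂ} (hx : 0 < x.re) (hy : 0 < y.re) :
    Gamma (x + y) * mellin (fun t : ℝ => (1 + t : ℂ) ^ (-(x + y))) x = Gamma x * Gamma y := by
  have hxy : x.re < (x + y).re := by simpa using hy
  rw [mellin_one_add_cpow_neg hx hxy, add_sub_cancel_left,
    mul_div_cancel₀ _ (Gamma_ne_zero_of_re_pos (hx.trans hxy))]

theorem continuousAt_one_add_cpow_neg (r : ℂ) {u : ℝ} (hu : 0 < u) :
    ContinuousAt (fun t : ℝ => (1 + t : ℂ) ^ (-r)) u :=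
  ContinuousAt.comp (g := fun z : ℂ => z ^ (-r)) (f := fun t : ℝ => (1 + t : ℂ))
    (continuousAt_cpow_const (Or.inl (by simpa using by positivity))) (by fun_prop)

theorem integral_Gamma_mul_Gamma_mul_cpow {a d : ℂ} (ha : 0 < a.re) (hd : 0 < d.re) {u : ℝ}
    (hu : 0 < u) :
    ∫ y : ℝ, (u : ℂ) ^ (-(y * I)) * (Gamma (a + y * I) * Gamma (d - y * I)) =
      2 * Real.pi * Gamma (a + d) * ((u : ℂ) ^ a * (1 + u : ℂ) ^ (-(a + d))) := by
  set f : ℝ → ℂ := fun t => (t : ℂ) ^ a • (1 + t : ℂ) ^ (-(a + d)) with hf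
  have hΓ : Gamma (a + d) ≠ 0 := Gamma_ne_zero_of_re_pos (by rw [add_re]; positivity)
  have hmellin (y : ℝ) : mellin f (y * I) =
      Gamma (a + y * I) * Gamma (d - y * I) / Gamma (a + d) := by
    rw [hf, mellin_cpow_smul, add_comm _ a,
      mellin_one_add_cpow_neg (by simpa using ha) (by simpa using hd)]
    ring_nf
  have hconv : MellinConvergent f (0 : ℝ) := by
    rw [hf, MellinConvergent.cpow_smul]
    exact mellinConvergent_one_add_cpow_neg (by simpa using ha) (by simpa using hd)
  have hvert : VerticalIntegrable (mellin f) 0 :=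
    ((integrable_Gamma_mul_Gamma_mul_I ha hd).div_const (Gamma (a + d))).congr
      (.of_forall fun y => by simp [hmellin])
  have hinv := mellinInv_mellin_eq 0 f hu hconv hvert
    ((continuousAt_ofReal_cpow_const _ _ (Or.inr hu.ne')).smul (continuousAt_one_add_cpow_neg _ hu))
  simp only [mellinInv, ofReal_zero, zero_add, hmellin, smul_eq_mul, mul_div_assoc',
    integral_div] at hinv
  change _ = 2 * Real.pi * Gamma (a + d) * f u
  rw [← hinv, real_smul]
  push_cast
  field_simp
  simp only [mul_comm I]

end BetaMellin

section BarnesFirstLemma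

open Complex

variable {a b e d s : ℂ} {γ : ℝ → ℂ}

/-- The value that Barnes' first lemma assigns to the contour integral of `barnesKernel a b e d`. -/
noncomputable def barnesValue (a b e d : ℂ) : ℂ :=
  2 * Real.pi * I *
    (Gamma (a + e) * Gamma (a + d) * Gamma (b + e) * Gamma (b + d) / Gamma (a + b + e + d))

theorem barnesValue_swap_left (a b e d : ℂ) : barnesValue a b e d = barnesValue b a e d := by
  rw [barnesValue, barnesValue, add_comm a b]
  ring

theorem barnesValue_swap_right (a b e d : ℂ) : barnesValue a b e d = barnesValue a b d e := by
  rw [barnesValue, barnesValue, add_right_comm (a + b)]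
  ring

theorem barnesKernel_eq_integral (a d : ℂ) (hb : 0 < (b + s).re) (he : 0 < (e - s).re) :
    barnesKernel a b e d s = ∫ u in Set.Ioi (0 : ℝ), (u : ℂ) ^ (-s) *
      (Gamma (a + s) * Gamma (d - s)) *
        (Gamma (e + b) * ((u : ℂ) ^ (e - 1) * (1 + u : ℂ) ^ (-(e + b)))) := by
  have hΓ := Gamma_add_mul_mellin_one_add_cpow_neg he hb
  rw [sub_add_add_cancel, mellin] at hΓ
  have hkernel : barnesKernel a b e d s =
      Gamma (a + s) * Gamma (d - s) * (Gamma (e - s) * Gamma (b + s)) := by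
    rw [barnesKernel]
    ring
  rw [hkernel, ← hΓ, ← mul_assoc, ← integral_const_mul]
  refine setIntegral_congr_fun measurableSet_Ioi fun u hu => ?_
  have hu : 0 < u := hu
  rw [show e - s - 1 = -s + (e - 1) by ring, cpow_add _ _ (by exact_mod_cast hu.ne'), smul_eq_mul]
  ring

theorem integrable_cpow_neg_mul_I_mul {M w : ℝ → ℂ} (hM : Integrable M)
    (hw : IntegrableOn w (Set.Ioi 0)) :
    Integrable (Function.uncurry fun (y u : ℝ) => (u : ℂ) ^ (-(y * I)) * M y * w u)
      (volume.prod (volume.restrict (Set.Ioi 0))) := by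
  have hmeas : Measurable fun p : ℝ × ℝ => (p.2 : ℂ) ^ (-(p.1 * I)) := by fun_prop
  have hpos : ∀ᵐ p : ℝ × ℝ ∂(volume.prod (volume.restrict (Set.Ioi 0))), 0 < p.2 :=
    (Measure.quasiMeasurePreserving_snd (μ := (volume : Measure ℝ))).ae
      (ae_restrict_mem measurableSet_Ioi)
  simp only [Function.uncurry_def, mul_assoc]
  refine (hM.mul_prod hw).bdd_mul (c := 1) hmeas.aestronglyMeasurable ?_
  filter_upwards [hpos] with p hp
  simp [norm_cpow_eq_rpow_re_of_pos hp]

/-- Parseval's identity for Mellin transforms: `Γ(e-s)Γ(b+s)` is a Beta integral over `u`, and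
the integral over `s` is then an inverse Mellin transform, again a product of powers of `u` and
`1 + u`. -/
theorem integral_barnesKernel_mul_I (ha : 0 < a.re) (hb : 0 < b.re) (he : 0 < e.re)
    (hd : 0 < d.re) :
    ∫ y : ℝ, barnesKernel a b e d (y * I) = 2 * Real.pi *
      (Gamma (a + e) * Gamma (a + d) * Gamma (b + e) * Gamma (b + d) / Gamma (a + b + e + d)) := by
  have hweight : IntegrableOn
      (fun u : ℝ => (u : ℂ) ^ (e - 1) * (1 + u : ℂ) ^ (-(e + b))) (Set.Ioi 0) :=
    mellinConvergent_one_add_cpow_neg he (by simpa using hb)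
  have hinner (u : ℝ) (hu : u ∈ Set.Ioi 0) : ∫ y : ℝ, (u : ℂ) ^ (-(y * I)) *
      (Gamma (a + y * I) * Gamma (d - y * I)) *
        (Gamma (e + b) * ((u : ℂ) ^ (e - 1) * (1 + u : ℂ) ^ (-(e + b)))) =
      2 * Real.pi * Gamma (e + b) * Gamma (a + d) *
        ((u : ℂ) ^ (a + e - 1) • (1 + u : ℂ) ^ (-(a + e + (b + d)))) := by
    have hu : 0 < u := hu
    have hu₁ : (1 + u : ℂ) ≠ 0 := by exact_mod_cast (by positivity : 1 + u ≠ 0)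
    rw [integral_mul_const, integral_Gamma_mul_Gamma_mul_cpow ha hd hu, add_sub_assoc,
      cpow_add _ _ (by exact_mod_cast hu.ne'),
      show -(a + e + (b + d)) = -(a + d) + -(e + b) by ring, cpow_add _ _ hu₁, smul_eq_mul]
    ring
  calc ∫ y : ℝ, barnesKernel a b e d (y * I)
      = ∫ y : ℝ, ∫ u in Set.Ioi (0 : ℝ), (u : ℂ) ^ (-(y * I)) *
          (Gamma (a + y * I) * Gamma (d - y * I)) *
            (Gamma (e + b) * ((u : ℂ) ^ (e - 1) * (1 + u : ℂ) ^ (-(e + b)))) :=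
        integral_congr_ae (.of_forall fun y =>
          barnesKernel_eq_integral a d (by simpa using hb) (by simpa using he))
    _ = ∫ u in Set.Ioi (0 : ℝ), 2 * Real.pi * Gamma (e + b) * Gamma (a + d) *
          ((u : ℂ) ^ (a + e - 1) • (1 + u : ℂ) ^ (-(a + e + (b + d)))) := by
        rw [integral_integral_swap (integrable_cpow_neg_mul_I_mul
          (integrable_Gamma_mul_Gamma_mul_I ha hd) (hweight.const_mul _))]
        exact setIntegral_congr_fun measurableSet_Ioi hinner
    _ = _ := by
        rw [integral_const_mul, ← mellin, mellin_one_add_cpow_neg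
          (by rw [add_re]; positivity) (by simp only [add_re]; linarith), add_sub_cancel_left,
          show a + e + (b + d) = a + b + e + d by ring, add_comm e b]
        ring

theorem hasContourIntegral_ofReal_mul_I_barnesKernel (ha : 0 < a.re) (hb : 0 < b.re)
    (he : 0 < e.re) (hd : 0 < d.re) :
    HasContourIntegral (fun t : ℝ => (t : ℂ) * I) (barnesKernel a b e d) (barnesValue a b e d) := by
  have hderiv (t : ℝ) : deriv (fun t : ℝ => (t : ℂ) * I) t = I := by
    simpa using ((ofRealCLM.hasDerivAt (x := t)).mul_const I).deriv
  have h := HasContourIntegral.of_integrable (γ := fun t : ℝ => (t : ℂ) * I)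
    (f := barnesKernel a b e d) (by
      simpa only [hderiv] using (integrable_barnesKernel_mul_I ha hb he hd).mul_const I)
  simp only [hderiv, integral_mul_const, integral_barnesKernel_mul_I ha hb he hd] at h
  rwa [mul_right_comm] at h

theorem barnesValue_add_one_left (hae : a + e ≠ 0) (had : a + d ≠ 0) :
    (a + b + e + d) * barnesValue (a + 1) b e d = (a + e) * (a + d) * barnesValue a b e d := by
  have hΓ := one_div_Gamma_eq_self_mul_one_div_Gamma_add_one (a + b + e + d)
  simp only [barnesValue, add_right_comm _ (1 : ℂ), Gamma_add_one _ hae, Gamma_add_one _ had,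
    div_eq_mul_inv, hΓ]
  ring

theorem barnesValue_add_one_right (hae : a + e ≠ 0) (hbe : b + e ≠ 0) :
    (a + b + e + d) * barnesValue a b (e + 1) d = (a + e) * (b + e) * barnesValue a b e d := by
  have hΓ := one_div_Gamma_eq_self_mul_one_div_Gamma_add_one (a + b + e + d)
  simp only [barnesValue, ← add_assoc, add_right_comm _ (1 : ℂ), Gamma_add_one _ hae,
    Gamma_add_one _ hbe, div_eq_mul_inv, hΓ]
  ring

theorem Separates.hasContourIntegral_of_add_one_left
    (h : Separates (leftPoles a b) (rightPoles e d) γ) (hae : a + e ≠ 0) (had : a + d ≠ 0)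
    (hraised : HasContourIntegral γ (barnesKernel (a + 1) b e d) (barnesValue (a + 1) b e d)) :
    HasContourIntegral γ (barnesKernel a b e d) (barnesValue a b e d) := by
  obtain ⟨J, hJ⟩ := exists_forall_separates_hasContourIntegral_barnesKernel a b e d
  rw [← mul_left_cancel₀ (mul_ne_zero hae had)
    ((h.contiguous_left (hJ γ h) hraised).trans (barnesValue_add_one_left hae had))]
  exact hJ γ h

theorem Separates.hasContourIntegral_of_add_one_right
    (h : Separates (leftPoles a b) (rightPoles e d) γ) (hae : a + e ≠ 0) (hbe : b + e ≠ 0)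
    (hraised : HasContourIntegral γ (barnesKernel a b (e + 1) d) (barnesValue a b (e + 1) d)) :
    HasContourIntegral γ (barnesKernel a b e d) (barnesValue a b e d) := by
  obtain ⟨J, hJ⟩ := exists_forall_separates_hasContourIntegral_barnesKernel a b e d
  rw [← mul_left_cancel₀ (mul_ne_zero hae hbe)
    ((h.contiguous_right (hJ γ h) hraised).trans (barnesValue_add_one_right hae hbe))]
  exact hJ γ h

theorem Separates.hasContourIntegral_of_add_one_left_left
    (h : Separates (leftPoles a b) (rightPoles e d) γ) (hae : a + e ≠ 0) (had : a + d ≠ 0)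
    (hbe : b + e ≠ 0) (hbd : b + d ≠ 0) (hraised : HasContourIntegral γ
      (barnesKernel (a + 1) (b + 1) e d) (barnesValue (a + 1) (b + 1) e d)) :
    HasContourIntegral γ (barnesKernel a b e d) (barnesValue a b e d) := by
  refine h.hasContourIntegral_of_add_one_left hae had ?_
  have hswap := leftPoles_comm (a + 1) b ▸ h.mono (leftPoles_add_one_subset a b) subset_rfl
  rw [barnesKernel_swap_left, barnesValue_swap_left] at hraised ⊢
  exact hswap.hasContourIntegral_of_add_one_left hbe hbd hraised

theorem Separates.hasContourIntegral_of_add_one_right_right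
    (h : Separates (leftPoles a b) (rightPoles e d) γ) (hae : a + e ≠ 0) (had : a + d ≠ 0)
    (hbe : b + e ≠ 0) (hbd : b + d ≠ 0) (hraised : HasContourIntegral γ
      (barnesKernel a b (e + 1) (d + 1)) (barnesValue a b (e + 1) (d + 1))) :
    HasContourIntegral γ (barnesKernel a b e d) (barnesValue a b e d) := by
  refine h.hasContourIntegral_of_add_one_right hae hbe ?_
  have hswap := rightPoles_comm (e + 1) d ▸ h.mono subset_rfl (rightPoles_add_one_subset e d)
  rw [barnesKernel_swap_right, barnesValue_swap_right] at hraised ⊢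
  exact hswap.hasContourIntegral_of_add_one_right had hbd hraised

theorem leftPoles_add_one_add_one_subset (a b : ℂ) : leftPoles (a + 1) (b + 1) ⊆ leftPoles a b :=
  fun s hs hs' => hs ⟨add_right_comm a s 1 ▸ hs'.1.add_one, add_right_comm b s 1 ▸ hs'.2.add_one⟩

theorem Separates.hasContourIntegral_of_add_one
    (h : Separates (leftPoles a b) (rightPoles e d) γ) (hae : Admissible (a + e))
    (had : Admissible (a + d)) (hbe : Admissible (b + e)) (hbd : Admissible (b + d))
    (hraised : HasContourIntegral γ (barnesKernel (a + 1) (b + 1) (e + 1) (d + 1))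
      (barnesValue (a + 1) (b + 1) (e + 1) (d + 1))) :
    HasContourIntegral γ (barnesKernel a b e d) (barnesValue a b e d) := by
  have hne (x y : ℂ) (hxy : Admissible (x + y)) : x + 1 + y ≠ 0 := by
    rw [add_right_comm]
    exact hxy.add_one.ne_zero
  exact h.hasContourIntegral_of_add_one_left_left hae.ne_zero had.ne_zero hbe.ne_zero hbd.ne_zero
    ((h.mono (leftPoles_add_one_add_one_subset a b)
      subset_rfl).hasContourIntegral_of_add_one_right_right (hne a e hae) (hne a d had)
        (hne b e hbe) (hne b d hbd) hraised)

theorem Separates.hasContourIntegral_barnesKernel_of_re_pos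
    (h : Separates (leftPoles a b) (rightPoles e d) γ) (ha : 0 < a.re) (hb : 0 < b.re)
    (he : 0 < e.re) (hd : 0 < d.re) :
    HasContourIntegral γ (barnesKernel a b e d) (barnesValue a b e d) := by
  obtain ⟨J, hJ⟩ := exists_forall_separates_hasContourIntegral_barnesKernel a b e d
  rw [(hasContourIntegral_ofReal_mul_I_barnesKernel ha hb he hd).unique
    (hJ _ (separates_poles_ofReal_mul_I ha hb he hd))]
  exact hJ γ h

theorem Admissible.add_one_add_one (h : Admissible (a + e)) : Admissible (a + 1 + (e + 1)) := by
  rw [add_add_add_comm, ← add_assoc]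
  exact h.add_one.add_one

theorem Separates.hasContourIntegral_barnesKernel_of_re_add_pos (N : ℕ)
    (h : Separates (leftPoles a b) (rightPoles e d) γ) (hae : Admissible (a + e))
    (had : Admissible (a + d)) (hbe : Admissible (b + e)) (hbd : Admissible (b + d))
    (ha : 0 < a.re + N) (hb : 0 < b.re + N) (he : 0 < e.re + N) (hd : 0 < d.re + N) :
    HasContourIntegral γ (barnesKernel a b e d) (barnesValue a b e d) := by
  induction N generalizing a b e d with
  | zero =>
    rw [Nat.cast_zero, add_zero] at ha hb he hd
    exact h.hasContourIntegral_barnesKernel_of_re_pos ha hb he hd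
  | succ N ih =>
    have hre (x : ℂ) (hx : 0 < x.re + (N + 1 : ℕ)) : 0 < (x + 1).re + N := by
      rw [add_re, one_re]
      push_cast at hx
      linarith
    exact h.hasContourIntegral_of_add_one hae had hbe hbd
      (ih (h.mono (leftPoles_add_one_add_one_subset a b) (rightPoles_add_one_add_one_subset e d))
        hae.add_one_add_one had.add_one_add_one hbe.add_one_add_one hbd.add_one_add_one
        (hre a ha) (hre b hb) (hre e he) (hre d hd))

theorem Separates.hasContourIntegral_barnesKernel
    (h : Separates (leftPoles a b) (rightPoles e d) γ) (hae : Admissible (a + e))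
    (had : Admissible (a + d)) (hbe : Admissible (b + e)) (hbd : Admissible (b + d)) :
    HasContourIntegral γ (barnesKernel a b e d) (barnesValue a b e d) := by
  have hlarge (x : ℝ) : ∀ᶠ N : ℕ in atTop, 0 < x + N :=
    (tendsto_atTop_add_const_left _ x tendsto_natCast_atTop_atTop).eventually_gt_atTop 0
  obtain ⟨N, ha, hb, he, hd⟩ :=
    ((hlarge a.re).and ((hlarge b.re).and ((hlarge e.re).and (hlarge d.re)))).exists
  exact h.hasContourIntegral_barnesKernel_of_re_add_pos N hae had hbe hbd ha hb he hd

end BarnesFirstLemma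

section BarnesIntegral

open Complex

variable {a b e d s w z : ℂ} {γ : ℝ → ℂ}

theorem norm_cpow_le_exp (hz : z ≠ 0) (w : ℂ) :
    ‖z ^ w‖ ≤ Real.exp (|Real.log ‖z‖| * |w.re| + Real.pi * |w.im|) := by
  rw [norm_cpow_of_ne_zero hz, div_eq_mul_inv, ← Real.exp_neg,
    Real.rpow_def_of_pos (norm_pos_iff.2 hz), ← Real.exp_add]
  refine Real.exp_le_exp.2 (add_le_add ?_ ?_)
  · rw [← abs_mul]
    exact le_abs_self _
  · refine (neg_le_abs _).trans ?_
    rw [abs_mul]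
    exact mul_le_mul_of_nonneg_right (abs_arg_le_pi z) (abs_nonneg _)

theorem norm_cpow_sub_le {B l : ℝ} (hz : z ≠ 0) (hl : |Real.log ‖z‖| ≤ l) (d : ℂ)
    (hs : |s.re| ≤ B) : ‖z ^ (s - d)‖ ≤
      Real.exp (l * (B + |d.re|) + Real.pi * |d.im|) * Real.exp (Real.pi * |s.im|) := by
  have hl₀ : 0 ≤ l := (abs_nonneg _).trans hl
  have hre : |(s - d).re| ≤ B + |d.re| := (abs_sub _ _).trans (add_le_add_left hs _)
  have him : |(s - d).im| ≤ |d.im| + |s.im| := (abs_sub _ _).trans (add_comm _ _).le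
  refine (norm_cpow_le_exp hz _).trans ?_
  rw [← Real.exp_add, add_assoc, ← mul_add]
  gcongr

theorem cpow_sub_isBigO_stripEnds (hz : z ≠ 0) (d : ℂ) (B : ℝ) :
    (fun s => z ^ (s - d)) =O[stripEnds B] fun s => Real.exp (Real.pi * |s.im|) := by
  refine .of_bound (Real.exp (|Real.log ‖z‖| * (B + |d.re|) + Real.pi * |d.im|)) ?_
  filter_upwards [eventually_mem_verticalStrip B] with s hs
  rw [Real.norm_of_nonneg (Real.exp_pos _).le]
  exact norm_cpow_sub_le hz le_rfl d (show |s.re| < B from hs).le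

theorem exists_norm_barnesKernel_mul_exp_le (hγ : IsTamePath γ)
    (h : Separates (leftPoles a b) (rightPoles e d) γ) :
    ∃ C, ∀ t, ‖barnesKernel a b e d (γ t)‖ * Real.exp (Real.pi * |(γ t).im|) ≤
      C * Real.exp (-(4 * Real.pi / 3 - Real.pi) * |t|) := by
  have hcont := hγ.contDiff.continuous
  obtain ⟨C, hC⟩ := hγ.exists_norm_comp_le
    (f := fun s => barnesKernel a b e d s * ((Real.exp (Real.pi * |s.im|) : ℝ) : ℂ))
    (δ := 4 * Real.pi / 3 - Real.pi) (by linarith [Real.pi_pos])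
    (h.continuous_barnesKernel.mul (by fun_prop)) fun B => barnesKernel_mul_isBigO_stripEnds _ _ _ _
      (.of_bound 1 (.of_forall fun s => by rw [norm_real, one_mul]))
  refine ⟨C, fun t => (le_of_eq ?_).trans (hC t)⟩
  rw [norm_mul, norm_real, Real.norm_of_nonneg (Real.exp_pos _).le]

/-- The integrand, in the parameter of `γ`, of Barnes' integral of `barnesKernel a b e d s` against
`z ^ (s - d)`. The shift by `d` makes differentiation in `z` raise `d` by `1`. -/
noncomputable def barnesIntegrand (a b e d : ℂ) (γ : ℝ → ℂ) (z : ℂ) (t : ℝ) : ℂ :=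
  barnesKernel a b e d (γ t) * z ^ (γ t - d) * deriv γ t

/-- Barnes' integral along `γ`, as an absolutely convergent integral; `γ` should be a tame path
that separates the poles. -/
noncomputable def barnesIntegral (a b e d : ℂ) (γ : ℝ → ℂ) (z : ℂ) : ℂ :=
  ∫ t, barnesIntegrand a b e d γ z t

theorem continuous_barnesIntegrand (hγ : IsTamePath γ)
    (h : Separates (leftPoles a b) (rightPoles e d) γ) (hz : z ≠ 0) :
    Continuous (barnesIntegrand a b e d γ z) :=
  (h.continuous_barnesKernel.mul
    ((hγ.contDiff.continuous.sub continuous_const).const_cpow (Or.inl hz))).mul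
    (hγ.contDiff.continuous_deriv le_rfl)

theorem exists_integrable_norm_barnesIntegrand_le (hγ : IsTamePath γ)
    (h : Separates (leftPoles a b) (rightPoles e d) γ) (l : ℝ) :
    ∃ g : ℝ → ℝ, Integrable g ∧ ∀ z : ℂ, z ≠ 0 → |Real.log ‖z‖| ≤ l →
      ∀ t, ‖barnesIntegrand a b e d γ z t‖ ≤ g t := by
  obtain ⟨C, hC⟩ := exists_norm_barnesKernel_mul_exp_le hγ h
  obtain ⟨M, hM⟩ := hγ.exists_norm_deriv_le
  obtain ⟨B, hB⟩ := hγ.exists_abs_re_le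
  set K := Real.exp (l * (B + |d.re|) + Real.pi * |d.im|)
  refine ⟨fun t => K * (C * Real.exp (-(4 * Real.pi / 3 - Real.pi) * |t|)) * M,
    (((integrable_exp_neg_mul_abs (by linarith [Real.pi_pos])).const_mul C).const_mul K).mul_const
      M, fun z hz hl t => ?_⟩
  calc ‖barnesIntegrand a b e d γ z t‖
      = ‖barnesKernel a b e d (γ t)‖ * ‖z ^ (γ t - d)‖ * ‖deriv γ t‖ := by
        rw [barnesIntegrand, norm_mul, norm_mul]
    _ ≤ ‖barnesKernel a b e d (γ t)‖ * (K * Real.exp (Real.pi * |(γ t).im|)) * M := by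
        gcongr
        exacts [norm_cpow_sub_le hz hl d (hB t), hM t]
    _ = K * (‖barnesKernel a b e d (γ t)‖ * Real.exp (Real.pi * |(γ t).im|)) * M := by ring
    _ ≤ K * (C * Real.exp (-(4 * Real.pi / 3 - Real.pi) * |t|)) * M :=
        mul_le_mul_of_nonneg_right (mul_le_mul_of_nonneg_left (hC t) (Real.exp_pos _).le)
          ((norm_nonneg _).trans (hM t))

theorem integrable_barnesIntegrand (hγ : IsTamePath γ)
    (h : Separates (leftPoles a b) (rightPoles e d) γ) (hz : z ≠ 0) :
    Integrable (barnesIntegrand a b e d γ z) := by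
  obtain ⟨g, hg, hbound⟩ := exists_integrable_norm_barnesIntegrand_le hγ h |Real.log ‖z‖|
  exact hg.mono' (continuous_barnesIntegrand hγ h hz).aestronglyMeasurable
    (.of_forall (hbound z hz le_rfl))

theorem hasContourIntegral_barnesIntegral (hγ : IsTamePath γ)
    (h : Separates (leftPoles a b) (rightPoles e d) γ) (hz : z ≠ 0) :
    HasContourIntegral γ (fun s => barnesKernel a b e d s * z ^ (s - d))
      (barnesIntegral a b e d γ z) :=
  .of_integrable (integrable_barnesIntegrand hγ h hz)

theorem Separates.hasContourIntegral_barnesIntegral {γ₀ : ℝ → ℂ}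
    (h : Separates (leftPoles a b) (rightPoles e d) γ) (hγ₀ : IsTamePath γ₀)
    (h₀ : Separates (leftPoles a b) (rightPoles e d) γ₀) (hz : z ≠ 0) :
    HasContourIntegral γ (fun s => barnesKernel a b e d s * z ^ (s - d))
      (barnesIntegral a b e d γ₀ z) := by
  obtain ⟨J, hJ⟩ := exists_forall_separates_hasContourIntegral_barnesKernel_mul a b e d
    (φ := fun s => z ^ (s - d)) (κ := Real.pi)
    (fun s => (differentiableAt_id.sub_const d).const_cpow (Or.inl hz)) (by linarith [Real.pi_pos])
    (cpow_sub_isBigO_stripEnds hz d)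
  rw [(_root_.hasContourIntegral_barnesIntegral hγ₀ h₀ hz).unique (hJ γ₀ h₀)]
  exact hJ γ h

theorem Separates.add_one_right (h : Separates (leftPoles a b) (rightPoles e d) γ) :
    Separates (leftPoles a b) (rightPoles e (d + 1)) γ := by
  rw [rightPoles_comm] at h ⊢
  exact h.mono subset_rfl (rightPoles_add_one_subset d e)

theorem Separates.add_nat_right (h : Separates (leftPoles a b) (rightPoles e d) γ) (n : ℕ) :
    Separates (leftPoles a b) (rightPoles e (d + n)) γ := by
  induction n with
  | zero => simpa using h
  | succ n ih => simpa [add_assoc] using ih.add_one_right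

theorem hasDerivAt_barnesIntegrand (h : Separates (leftPoles a b) (rightPoles e d) γ) (t : ℝ)
    (hz : z ∈ slitPlane) :
    HasDerivAt (fun z => barnesIntegrand a b e d γ z t)
      (-barnesIntegrand a b e (d + 1) γ z t) z := by
  have hcpow : HasDerivAt (fun z : ℂ => z ^ (γ t - d)) ((γ t - d) * z ^ (γ t - d - 1) * 1) z :=
    (hasDerivAt_id z).cpow_const hz
  refine ((hcpow.const_mul (barnesKernel a b e d (γ t))).mul_const (deriv γ t)).congr_deriv ?_
  rw [barnesIntegrand, barnesKernel_swap_right a b e (d + 1),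
    barnesKernel_add_one_right (h.poles_ne_zero t).2.2, barnesKernel_swap_right a b d, sub_sub]
  ring

theorem hasDerivAt_barnesIntegral (hγ : IsTamePath γ)
    (h : Separates (leftPoles a b) (rightPoles e d) γ) (hz : z ∈ slitPlane) :
    HasDerivAt (barnesIntegral a b e d γ) (-barnesIntegral a b e (d + 1) γ z) z := by
  have hz₀ := slitPlane_ne_zero hz
  obtain ⟨g, hg, hbound⟩ :=
    exists_integrable_norm_barnesIntegrand_le hγ h.add_one_right (|Real.log ‖z‖| + 1)
  have hlog : ContinuousAt (fun z : ℂ => |Real.log ‖z‖|) z :=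
    (continuous_norm.continuousAt.log (norm_ne_zero_iff.2 hz₀)).abs
  have hnhds : {w : ℂ | w ∈ slitPlane ∧ |Real.log ‖w‖| < |Real.log ‖z‖| + 1} ∈ 𝓝 z :=
    (isOpen_slitPlane.eventually_mem hz).and (hlog.eventually_lt_const (lt_add_one _))
  rw [barnesIntegral, ← integral_neg]
  refine (hasDerivAt_integral_of_dominated_loc_of_deriv_le (bound := g) hnhds ?_
    (integrable_barnesIntegrand hγ h hz₀) ?_ ?_ hg
    (.of_forall fun t w hw => hasDerivAt_barnesIntegrand h t hw.1)).2
  · filter_upwards [isOpen_slitPlane.eventually_mem hz] with w hw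
    exact (continuous_barnesIntegrand hγ h (slitPlane_ne_zero hw)).aestronglyMeasurable
  · exact (continuous_barnesIntegrand hγ h.add_one_right hz₀).neg.aestronglyMeasurable
  · refine .of_forall fun t w hw => ?_
    rw [norm_neg]
    exact hbound w (slitPlane_ne_zero hw.1) hw.2.le t

theorem iteratedDeriv_barnesIntegral (hγ : IsTamePath γ)
    (h : Separates (leftPoles a b) (rightPoles e d) γ) (n : ℕ) (hz : z ∈ slitPlane) :
    iteratedDeriv n (barnesIntegral a b e d γ) z =
      (-1) ^ n * barnesIntegral a b e (d + n) γ z := by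
  induction n generalizing z with
  | zero => simp
  | succ n ih =>
    have hev : iteratedDeriv n (barnesIntegral a b e d γ) =ᶠ[𝓝 z]
        fun z => (-1) ^ n * barnesIntegral a b e (d + n) γ z :=
      (isOpen_slitPlane.eventually_mem hz).mono fun w hw => ih hw
    rw [iteratedDeriv_succ, hev.deriv_eq,
      ((hasDerivAt_barnesIntegral hγ (h.add_nat_right n) hz).const_mul _).deriv, pow_succ,
      Nat.cast_succ, add_assoc]
    ring

theorem barnesIntegral_one (hγ : IsTamePath γ) (h : Separates (leftPoles a b) (rightPoles e d) γ)
    (hae : Admissible (a + e)) (had : Admissible (a + d)) (hbe : Admissible (b + e))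
    (hbd : Admissible (b + d)) : barnesIntegral a b e d γ 1 = barnesValue a b e d := by
  have hone := hasContourIntegral_barnesIntegral hγ h one_ne_zero
  simp only [one_cpow, mul_one] at hone
  exact hone.unique (h.hasContourIntegral_barnesKernel hae had hbe hbd)

end BarnesIntegral

section GaussContinuation

open Complex

variable {a b c e d w z ξ : ℂ} {γ : ℝ → ℂ}

theorem Admissible.add_nat (h : Admissible ξ) (n : ℕ) : Admissible (ξ + n) := fun m hm =>
  h (m + n) (by push_cast; linear_combination hm)

theorem Admissible.Gamma_ne_zero (h : Admissible ξ) : Gamma ξ ≠ 0 :=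
  Complex.Gamma_ne_zero h

theorem Admissible.Gamma_add_nat (h : Admissible ξ) (n : ℕ) :
    Gamma (ξ + n) = (ascPochhammer ℂ n).eval ξ * Gamma ξ := by
  rw [← Gamma_add_nat_div_Gamma_eq ξ h, div_mul_cancel₀ _ h.Gamma_ne_zero]

theorem barnesValue_ne_zero (hae : Admissible (a + e)) (had : Admissible (a + d))
    (hbe : Admissible (b + e)) (hbd : Admissible (b + d)) (hc : Admissible (a + b + e + d)) :
    barnesValue a b e d ≠ 0 :=
  mul_ne_zero two_pi_I_ne_zero (div_ne_zero (mul_ne_zero (mul_ne_zero (mul_ne_zero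
    hae.Gamma_ne_zero had.Gamma_ne_zero) hbe.Gamma_ne_zero) hbd.Gamma_ne_zero) hc.Gamma_ne_zero)

theorem barnesValue_add_nat (had : Admissible (a + d)) (hbd : Admissible (b + d))
    (hc : Admissible (a + b + e + d)) (n : ℕ) :
    barnesValue a b e (d + n) = barnesValue a b e d * ((ascPochhammer ℂ n).eval (a + d) *
      (ascPochhammer ℂ n).eval (b + d) * ((ascPochhammer ℂ n).eval (a + b + e + d))⁻¹) := by
  simp only [barnesValue, ← add_assoc, had.Gamma_add_nat, hbd.Gamma_add_nat, hc.Gamma_add_nat,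
    div_eq_mul_inv, mul_inv]
  ring

theorem barnesIntegral_one_sub (hγ : IsTamePath γ)
    (h : Separates (leftPoles a b) (rightPoles e d) γ) (hae : Admissible (a + e))
    (had : Admissible (a + d)) (hbe : Admissible (b + e)) (hbd : Admissible (b + d))
    (hc : Admissible (a + b + e + d)) (hw : ‖w‖ < 1) :
    barnesIntegral a b e d γ (1 - w) = barnesValue a b e d *
      ordinaryHypergeometric (a + d) (b + d) (a + b + e + d) w := by
  have hball {z : ℂ} (hz : z ∈ Metric.ball 1 1) : z ∈ slitPlane := by
    simpa using mem_slitPlane_of_norm_lt_one (z := z - 1) (by simpa [dist_eq_norm] using hz)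
  have hdiff : DifferentiableOn ℂ (barnesIntegral a b e d γ) (Metric.ball 1 1) := fun z hz =>
    (hasDerivAt_barnesIntegral hγ h (hball hz)).differentiableAt.differentiableWithinAt
  have hcoeff (n : ℕ) : iteratedDeriv n (barnesIntegral a b e d γ) 1 =
      (-1) ^ n * barnesValue a b e (d + n) := by
    rw [iteratedDeriv_barnesIntegral hγ h n one_mem_slitPlane, barnesIntegral_one hγ
      (h.add_nat_right n) hae (add_assoc a d n ▸ had.add_nat n) hbe
      (add_assoc b d n ▸ hbd.add_nat n)]
  rw [← taylorSeries_eq_on_ball' (z := 1 - w) (by simpa [dist_eq_norm] using hw) hdiff,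
    ordinaryHypergeometric_eq_tsum]
  dsimp only
  rw [← tsum_mul_left]
  refine tsum_congr fun n => ?_
  have hpow : (1 - w - 1) ^ n = (-1) ^ n * w ^ n := by
    rw [sub_sub_cancel_left, neg_pow]
  have hsign : (-1 : ℂ) ^ n * (-1) ^ n = 1 := by
    rw [← mul_pow, neg_one_mul, neg_neg, one_pow]
  rw [hcoeff, barnesValue_add_nat had hbd hc, hpow, smul_eq_mul]
  linear_combination ((n.factorial : ℂ)⁻¹ * (barnesValue a b e d *
    ((ascPochhammer ℂ n).eval (a + d) * (ascPochhammer ℂ n).eval (b + d) *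
      ((ascPochhammer ℂ n).eval (a + b + e + d))⁻¹)) * w ^ n) * hsign

theorem isGaussContinuation_barnesIntegral (hγ : IsTamePath γ)
    (h : Separates (leftPoles a b) (rightPoles e d) γ) (hae : Admissible (a + e))
    (had : Admissible (a + d)) (hbe : Admissible (b + e)) (hbd : Admissible (b + d))
    (hc : Admissible (a + b + e + d)) :
    IsGaussContinuation (a + d) (b + d) (a + b + e + d) fun w =>
      (barnesValue a b e d)⁻¹ * barnesIntegral a b e d γ (1 - w) := by
  refine ⟨fun w hw => ?_, fun w hw => ?_⟩
  · have hdiff := (hasDerivAt_barnesIntegral hγ h hw).differentiableAt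
    exact ((hdiff.comp w (f := fun w => 1 - w) (by fun_prop)).const_mul _).differentiableWithinAt
  · dsimp only
    rw [barnesIntegral_one_sub hγ h hae had hbe hbd hc hw,
      inv_mul_cancel_left₀ (barnesValue_ne_zero hae had hbe hbd hc)]

theorem isOpen_one_sub_mem_slitPlane : IsOpen {w : ℂ | 1 - w ∈ slitPlane} :=
  isOpen_slitPlane.preimage (continuous_const.sub continuous_id)

theorem isPreconnected_one_sub_mem_slitPlane : IsPreconnected {w : ℂ | 1 - w ∈ slitPlane} := by
  have himage : {w : ℂ | 1 - w ∈ slitPlane} = (fun z => 1 - z) '' slitPlane := by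
    ext w
    exact ⟨fun h => ⟨1 - w, h, sub_sub_cancel 1 w⟩, by rintro ⟨z, hz, rfl⟩; simpa using hz⟩
  rw [himage]
  exact (starConvex_one_slitPlane.isPathConnected
    one_mem_slitPlane).isConnected.isPreconnected.image _ (by fun_prop)

theorem IsGaussContinuation.eqOn {f g : ℂ → ℂ} (hf : IsGaussContinuation a b c f)
    (hg : IsGaussContinuation a b c g) : Set.EqOn f g {w | 1 - w ∈ slitPlane} := by
  refine (hf.1.analyticOnNhd isOpen_one_sub_mem_slitPlane).eqOn_of_preconnected_of_eventuallyEq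
    (hg.1.analyticOnNhd isOpen_one_sub_mem_slitPlane) isPreconnected_one_sub_mem_slitPlane
    (z₀ := 0) (by simp) ?_
  filter_upwards [Metric.ball_mem_nhds (0 : ℂ) one_pos] with z hz
  have hz : ‖z‖ < 1 := by simpa using hz
  rw [hf.2 z hz, hg.2 z hz]

theorem isGaussContinuation_gaussF (hae : Admissible (a + e)) (had : Admissible (a + d))
    (hbe : Admissible (b + e)) (hbd : Admissible (b + d)) (hc : Admissible (a + b + e + d)) :
    IsGaussContinuation (a + d) (b + d) (a + b + e + d)
      (gaussF (a + d) (b + d) (a + b + e + d)) := by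
  obtain ⟨γ, -, hγ, h⟩ := exists_isTamePath_separates_poles hae had hbe hbd
  exact Classical.epsilon_spec ⟨_, isGaussContinuation_barnesIntegral hγ h hae had hbe hbd hc⟩

theorem Separates.hasContourIntegral_barnesKernel_mul_cpow
    (h : Separates (leftPoles a b) (rightPoles e d) γ) (hae : Admissible (a + e))
    (had : Admissible (a + d)) (hbe : Admissible (b + e)) (hbd : Admissible (b + d))
    (hc : Admissible (a + b + e + d)) (hz : z ∈ slitPlane) :
    HasContourIntegral γ (fun s => barnesKernel a b e d s * z ^ (s - d))
      (barnesValue a b e d * gaussF (a + d) (b + d) (a + b + e + d) (1 - z)) := by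
  obtain ⟨γ₀, -, hγ₀, h₀⟩ := exists_isTamePath_separates_poles hae had hbe hbd
  have hF := (isGaussContinuation_gaussF hae had hbe hbd hc).eqOn
    (isGaussContinuation_barnesIntegral hγ₀ h₀ hae had hbe hbd hc)
    (show 1 - z ∈ {w | 1 - w ∈ slitPlane} by simpa using hz)
  rw [hF, mul_inv_cancel_left₀ (barnesValue_ne_zero hae had hbe hbd hc), sub_sub_cancel]
  exact h.hasContourIntegral_barnesIntegral hγ₀ h₀ (slitPlane_ne_zero hz)

theorem isBarnesContour_iff :
    IsBarnesContour a b c γ ↔ Separates (leftPoles a b) (rightPoles (c - a - b) 0) γ := by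
  constructor
  · intro h
    refine ⟨h.vertical, fun p hp => ?_, fun p hp => ?_⟩
    · rcases not_and_or.1 hp with hp | hp <;> obtain ⟨n, hn⟩ := not_forall_not.1 hp
      · exact (by linear_combination hn : p = -a - n) ▸ h.left_a n
      · exact (by linear_combination hn : p = -b - n) ▸ h.left_b n
    · rcases not_and_or.1 hp with hp | hp <;> obtain ⟨n, hn⟩ := not_forall_not.1 hp
      · exact (by linear_combination -hn : p = c - a - b + n) ▸ h.right_c n
      · exact (by linear_combination -hn : p = n) ▸ h.right_zero n
  · exact fun h => ⟨h.vertical, fun n => h.left _ fun hs => hs.1 n (by ring),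
      fun n => h.left _ fun hs => hs.2 n (by ring), fun n => h.right _ fun hs => hs.2 n (by ring),
      fun n => h.right _ fun hs => hs.1 n (by ring)⟩

end GaussContinuation

theorem mainTheorem1 (a b c z : ℂ) (hz : z ∈ Complex.slitPlane)
    (ha : Admissible a) (hca : Admissible (c - a)) (hb : Admissible b)
    (hcb : Admissible (c - b)) (hc : Admissible c) :
    IsGaussContinuation a b c (gaussF a b c) ∧
    (∃ γ : ℝ → ℂ, Function.Injective γ ∧ IsBarnesContour a b c γ) ∧
    ∀ γ : ℝ → ℂ, IsBarnesContour a b c γ →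
      ∃ J : ℂ,
        HasContourIntegral γ
          (fun s => Complex.Gamma (a + s) * Complex.Gamma (b + s) *
            Complex.Gamma (c - a - b - s) * Complex.Gamma (-s) * z ^ s) J ∧
        Complex.Gamma a * Complex.Gamma (c - a) * Complex.Gamma b * Complex.Gamma (c - b) /
            Complex.Gamma c * gaussF a b c (1 - z) =
          1 / (2 * Real.pi * Complex.I) * J := by
  have hae : a + (c - a - b) = c - b := by ring
  have hbe : b + (c - a - b) = c - a := by ring
  have hsum : a + b + (c - a - b) + 0 = c := by ring
  rw [← add_zero a] at ha
  rw [← add_zero b] at hb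
  rw [← hbe] at hca
  rw [← hae] at hcb
  rw [← hsum] at hc
  have hF := isGaussContinuation_gaussF hcb ha hca hb hc
  obtain ⟨γ₀, hinj, -, h₀⟩ := exists_isTamePath_separates_poles hcb ha hca hb
  rw [add_zero, add_zero, hsum] at hF
  refine ⟨hF, ⟨γ₀, hinj, isBarnesContour_iff.2 h₀⟩, fun γ hγ =>
    ⟨barnesValue a b (c - a - b) 0 * gaussF a b c (1 - z), ?_, ?_⟩⟩
  · simpa only [barnesKernel, add_zero, hsum, sub_zero, zero_sub] using
      (isBarnesContour_iff.1 hγ).hasContourIntegral_barnesKernel_mul_cpow hcb ha hca hb hc hz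
  · rw [barnesValue, hae, hbe, add_zero, add_zero, hsum, one_div,
      mul_assoc (2 * Real.pi * Complex.I : ℂ), inv_mul_cancel_left₀ Complex.two_pi_I_ne_zero]
    ring
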